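/- **Expected complexity of STARS (stochastic trust region in random subspaces).** *Constants.* Let $\gamma>1$, $\eta_1\in(0,1)$, $\eta_2>0$, $\delta_0>0$, $j_{\max}\in\mathbb N$, $\delta_{\max}=\gamma^{j_{\max}}\delta_0$, $\kappa_{fcd}\in(0,1]$, $\kappa_{ef},\kappa_{eg}>0$, $\kappa_h\ge 1$, $Q_{\max}>0$, $L_g\ge 0$, $f_{\min}\in\mathbb R$, $\alpha_Q\in(0,1)$, $\beta_f,\beta_m\in(0,1)$, $0\le\beta_Q<1-\frac1{2\beta_f\beta_m}$, and $0<\varepsilon_f<\min\{\kappa_{ef},\frac14\eta_1\eta_2\kappa_{fcd}\min\{\frac{\eta_2}{\kappa_h},1\}\}$. Let $\zeta>0$ satisfy $\zeta\ge\kappa_{eg}+\max\{\eta_2,\kappa_h,\frac{8\kappa_{ef}}{\kappa_{fcd}(1-\eta_1)}\}$, put $$C_1=\tfrac{\kappa_{fcd}}4\max\Big\{\tfrac{\kappa_h}{\kappa_h+\kappa_{eg}},\tfrac{8\kappa_{ef}}{8\kappa_{ef}+\kappa_{fcd}\kappa_{eg}}\Big\},\quad C_2=\tfrac12\eta_1\eta_2\kappa_{fcd}\min\{\tfrac{\eta_2}{\kappa_h},1\}-2\varepsilon_f,\quad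 C_3=1+\tfrac{3L_g}{2\zeta}Q_{\max}^2,$$ and let $\nu\in(0,1)$ with $\frac{\nu}{1-\nu}\ge\frac{8\gamma^2}{\min\{C_2,\zeta C_1\}}$. Suppose $$\frac{\beta_f\beta_m-\frac12}{(1-\beta_f)+(1-\beta_m)}\ge\frac{C_3}{C_1},\qquad \frac{\beta_f}{1-\beta_f}\ge\frac{2\nu\zeta\gamma^2C_3}{(1-\nu)(\gamma^2-1)}+2\gamma^2 .$$ Put $\tilde\beta=\beta_f\beta_m(1-\beta_Q)$, $\varrho=\frac12\beta_f(1-\nu)(1-\gamma^{-2})$ and $\hat\xi=\frac1{\alpha_Q}\max\{\kappa_h+\kappa_{eg},\ \eta_2+\kappa_{eg},\ \frac{8\kappa_{ef}}{\kappa_{fcd}(1-\eta_1)}+\kappa_{eg}\}$. *Algorithm.* Let $1\le p\le n$, let $f:\mathbb R^n\to\mathbb R$ be continuously differentiable with $f\ge f_{\min}$, and $x_0\in\mathbb R^n$. On a probability space there are, for each $k\ge0$, a random matrix $Q_k\in\mathbb R^{n\times p}$, a random quadratic model $\hat m_k(s)=c_k+\hat g_k^\top s+\frac12s^\top\hat H_ks$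 on $\mathbb R^p$ with $\hat H_k$ symmetric, a random step $s_k\in\mathbb R^p$, and random estimates $f_k^0,f_k^s\in\mathbb R$. Iterates $x_k$ and radii $\delta_k$ start at $x_0,\delta_0$; if $\frac{f_k^0-f_k^s}{\hat m_k(0)-\hat m_k(s_k)}\ge\eta_1$ and $\|\hat g_k\|\ge\eta_2\delta_k$, then $x_{k+1}=x_k+Q_ks_k$ and $\delta_{k+1}=\min\{\gamma\delta_k,\delta_{\max}\}$; otherwise $x_{k+1}=x_k$ and $\delta_{k+1}=\gamma^{-1}\delta_k$. Vectors carry the Euclidean norm, and matrix norms are any norms consistent with it. Let $\mathcal F_{k-1}$ be the $\sigma$-algebra generated by $f_\ell^0,f_\ell^s,\hat m_\ell,Q_\ell$ for $\ell<k$ (trivial for $k=0$), $\mathcal F^Q_{k-1}=\mathcal F_{k-1}\vee\sigma(Q_k)$ and $\mathcal F^{\hat m\cdot Q}_{k-1}=\mathcal F^Q_{k-1}\vee\sigma(\hat m_k)$. *Assumptions.* For every realization and every $k$: $s_k$ is $\mathcal F^{\hat m\cdot Q}_{k-1}$-measurable, $\|s_k\|\le\delta_k$ and $$\hat m_k(0)-\hat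 m_k(s_k)\ge\tfrac{\kappa_{fcd}}2\|\hat g_k\|\min\Big\{\delta_k,\tfrac{\|\hat g_k\|}{\max(\|\hat H_k\|,1)}\Big\};$$ $\|Q_k\|\le Q_{\max}$ and $\|\hat H_k\|\le\kappa_h$; on $\bigcup_k\{x_k+Q_ks:\|s\|\le\delta_{\max}\}$, $f$ is Lipschitz (with a constant independent of the realization) and $\nabla f$ is $L_g$-Lipschitz. Moreover, almost surely for every $k$: * for every $\mathcal F_{k-1}$-measurable random vector $v$ in $\mathbb R^n$, $\mathbb P(\|Q_k^\top v\|\ge\alpha_Q\|v\|\mid\mathcal F_{k-1})\ge1-\beta_Q$; * $\mathbb P(I_k\mid\mathcal F^Q_{k-1})\ge\beta_m$, where $I_k$ is the event that $|f(x_k+Q_ks)-\hat m_k(s)|\le\kappa_{ef}\delta_k^2$ and $\|Q_k^\top\nabla f(x_k+Q_ks)-\nabla\hat m_k(s)\|\le\kappa_{eg}\delta_k$ for all $\|s\|\le\delta_k$; * $\mathbb P(J_k\mid\mathcal F^{\hat m\cdot Q}_{k-1})\ge\beta_f$, where $J_k$ is the event that $|f_k^0-f(x_k)|\le\varepsilon_f\delta_k^2$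 and $|f_k^s-f(x_k+Q_ks_k)|\le\varepsilon_f\delta_k^2$. *Conclusion.* There is $\tilde\xi\ge\hat\xi$, depending only on the constants above, such that for every such $f$, $x_0$ and run of the algorithm and every $\epsilon\in(0,1)$, the hitting time $\tau_\epsilon=\inf\{k\ge0:\|\nabla f(x_k)\|\le\epsilon\}$ satisfies $$\mathbb E[\tau_\epsilon]\le\frac{\tilde\beta}{2\tilde\beta-1}\cdot\frac{\phi_0\,\tilde\xi^2}{\varrho\,\epsilon^2}+1,\qquad \phi_0=\nu(f(x_0)-f_{\min})+(1-\nu)\delta_0^2 .$$ In particular $\mathbb E[\tau_\epsilon]=O(\epsilon^{-2})$. -/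

import Mathlib

open MeasureTheory ProbabilityTheory
open scoped NNReal ENNReal

noncomputable section

namespace STARS

/-- Euclidean space of dimension `n`. -/
abbrev E (n : ℕ) : Type := EuclideanSpace ℝ (Fin n)

/-- The product of a matrix with a Euclidean vector. -/
def mulE {m n : ℕ} (A : Matrix (Fin m) (Fin n) ℝ) (v : E n) : E m :=
  WithLp.toLp 2 (A.mulVec v.ofLp)

/-- A matrix norm is consistent with the Euclidean norm if `‖A v‖ ≤ N A * ‖v‖` for all `A`, `v`.
(For a seminorm `N` this forces `N A = 0` only for `A = 0`, so `N` is a norm.) -/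
def Consistent {m n : ℕ} (N : Seminorm ℝ (Matrix (Fin m) (Fin n) ℝ)) : Prop :=
  ∀ (A : Matrix (Fin m) (Fin n) ℝ) (v : E n), ‖mulE A v‖ ≤ N A * ‖v‖

/-- All the constants: those chosen by the algorithm and those of its analysis. -/
structure Params where
  /-- trust-region update factor -/
  γ : ℝ
  /-- threshold for the ratio of decreases -/
  η₁ : ℝ
  /-- threshold for the size of the model gradient -/
  η₂ : ℝ
  /-- initial trust-region radius -/
  δ₀ : ℝ
  /-- the maximal radius is `γ ^ jmax * δ₀` -/
  jmax : ℕ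
  /-- fraction of Cauchy decrease -/
  κfcd : ℝ
  /-- model accuracy, function values -/
  κef : ℝ
  /-- model accuracy, gradients -/
  κeg : ℝ
  /-- bound on the model Hessians -/
  κh : ℝ
  /-- accuracy of the estimates -/
  εf : ℝ
  /-- bound on the subspace matrices -/
  Qmax : ℝ
  /-- Lipschitz constant of the gradient -/
  Lg : ℝ≥0
  /-- lower bound of the objective -/
  fmin : ℝ
  /-- well-alignment constant -/
  αQ : ℝ
  /-- failure probability of well-alignment -/
  βQ : ℝ
  /-- probability of fully linear models -/
  βm : ℝ
  /-- probability of accurate estimates -/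
  βf : ℝ
  /-- ratio between the projected gradient and the radius that separates the two regimes -/
  ζ : ℝ
  /-- weight in the merit function -/
  ν : ℝ

namespace Params

variable (P : Params)

/-- The maximal trust-region radius. -/
def δmax : ℝ := P.γ ^ P.jmax * P.δ₀

def C₁ : ℝ := P.κfcd / 4 *
  max (P.κh / (P.κh + P.κeg)) (8 * P.κef / (8 * P.κef + P.κfcd * P.κeg))

def C₂ : ℝ := 1 / 2 * P.η₁ * P.η₂ * P.κfcd * min (P.η₂ / P.κh) 1 - 2 * P.εf

def C₃ : ℝ := 1 + 3 * (P.Lg : ℝ) / (2 * P.ζ) * P.Qmax ^ 2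

/-- The constant `ϱ` of the expected decrease of the merit function. -/
def ϱ : ℝ := 1 / 2 * P.βf * (1 - P.ν) * (1 - 1 / P.γ ^ 2)

/-- The probability `β̃` of true iterations. -/
def βtilde : ℝ := P.βf * P.βm * (1 - P.βQ)

/-- The constant `ξ̂`. -/
def ξhat : ℝ := 1 / P.αQ *
  max (P.κh + P.κeg)
    (max (P.η₂ + P.κeg) (8 * P.κef / (P.κfcd * (1 - P.η₁)) + P.κeg))

/-- The merit function `ν (f x - fmin) + (1 - ν) δ ^ 2`, whose value along the run is `φ_k`. -/
def merit {n : ℕ} (f : E n → ℝ) (x : E n) (δ : ℝ) : ℝ :=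
  P.ν * (f x - P.fmin) + (1 - P.ν) * δ ^ 2

/-- The ranges of the constants and the inequalities between them. -/
structure Admissible : Prop where
  γ_gt : 1 < P.γ
  η₁_pos : 0 < P.η₁
  η₁_lt : P.η₁ < 1
  η₂_pos : 0 < P.η₂
  δ₀_pos : 0 < P.δ₀
  κfcd_pos : 0 < P.κfcd
  κfcd_le : P.κfcd ≤ 1
  κef_pos : 0 < P.κef
  κeg_pos : 0 < P.κeg
  κh_ge : 1 ≤ P.κh
  εf_pos : 0 < P.εf
  εf_lt : P.εf < min P.κef (1 / 4 * P.η₁ * P.η₂ * P.κfcd * min (P.η₂ / P.κh) 1)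
  Qmax_pos : 0 < P.Qmax
  αQ_pos : 0 < P.αQ
  αQ_lt : P.αQ < 1
  βm_pos : 0 < P.βm
  βm_lt : P.βm < 1
  βf_pos : 0 < P.βf
  βf_lt : P.βf < 1
  βQ_nonneg : 0 ≤ P.βQ
  βQ_lt : P.βQ < 1 - 1 / (2 * P.βf * P.βm)
  ζ_pos : 0 < P.ζ
  ζ_ge : P.κeg + max P.η₂ (max P.κh (8 * P.κef / (P.κfcd * (1 - P.η₁)))) ≤ P.ζ
  ν_pos : 0 < P.ν
  ν_lt : P.ν < 1
  ν_ge : 8 * P.γ ^ 2 / min P.C₂ (P.ζ * P.C₁) ≤ P.ν / (1 - P.ν)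
  prob_ge : P.C₃ / P.C₁ ≤ (P.βf * P.βm - 1 / 2) / ((1 - P.βf) + (1 - P.βm))
  βf_ge : 2 * P.ν * P.ζ * P.γ ^ 2 * P.C₃ / ((1 - P.ν) * (P.γ ^ 2 - 1)) + 2 * P.γ ^ 2
    ≤ P.βf / (1 - P.βf)

end Params

/-- The random quantities produced at each iteration: the subspace matrix `Q k`, the coefficients
`c k`, `g k`, `H k` of the quadratic subspace model, the trial step `s k`, and the estimates
`f0 k`, `fs k` of the objective at the current iterate and at the trial point. -/
structure Data (n p : ℕ) (Ω : Type*) where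
  Q : ℕ → Ω → Matrix (Fin n) (Fin p) ℝ
  c : ℕ → Ω → ℝ
  g : ℕ → Ω → E p
  H : ℕ → Ω → Matrix (Fin p) (Fin p) ℝ
  s : ℕ → Ω → E p
  f0 : ℕ → Ω → ℝ
  fs : ℕ → Ω → ℝ

/-- The quadratic model with value `c`, gradient `g` and Hessian `H` at the origin. -/
def quadModel {p : ℕ} (c : ℝ) (g : E p) (H : Matrix (Fin p) (Fin p) ℝ) (s : E p) : ℝ :=
  c + inner ℝ g s + 1 / 2 * inner ℝ s (mulE H s)

/-- `m` is a `(κef, κeg; Q)`-fully linear model of `f` on `{x + Q s : ‖s‖ ≤ δ}`. -/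
def FullyLinear {n p : ℕ} (κef κeg : ℝ) (f : E n → ℝ) (Q : Matrix (Fin n) (Fin p) ℝ)
    (x : E n) (δ : ℝ) (m : E p → ℝ) : Prop :=
  ∀ s : E p, ‖s‖ ≤ δ →
    |f (x + mulE Q s) - m s| ≤ κef * δ ^ 2 ∧
    ‖mulE Q.transpose (gradient f (x + mulE Q s)) - gradient m s‖ ≤ κeg * δ

/-- `a` and `b` are `εf`-accurate estimates of `f x` and `f y` for the radius `δ`. -/
def Accurate {n : ℕ} (εf : ℝ) (f : E n → ℝ) (x y : E n) (δ a b : ℝ) : Prop :=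
  |a - f x| ≤ εf * δ ^ 2 ∧ |b - f y| ≤ εf * δ ^ 2

/-- `P(B | m) ≥ b` almost surely, for a sub-σ-algebra `m`. -/
def CondProbGE {Ω : Type*} {mΩ : MeasurableSpace Ω} (μ : Measure Ω)
    (m : MeasurableSpace Ω) (B : Set Ω) (b : ℝ) : Prop :=
  ∀ᵐ ω ∂μ, b ≤ (μ[B.indicator (fun _ => (1 : ℝ)) | m]) ω

namespace Data

variable {n p : ℕ} {Ω : Type*} (D : Data n p Ω) (P : Params) (f : E n → ℝ) (x₀ : E n)

/-- The random subspace model of iteration `k`. -/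
def model (k : ℕ) (ω : Ω) : E p → ℝ := quadModel (D.c k ω) (D.g k ω) (D.H k ω)

/-- The ratio `ρ_k` of estimated and predicted decrease. -/
def ratio (k : ℕ) (ω : Ω) : ℝ :=
  (D.f0 k ω - D.fs k ω) / (D.model k ω 0 - D.model k ω (D.s k ω))

/-- Acceptance test of iteration `k`, when the current radius is `δ`. -/
def Accept (k : ℕ) (ω : Ω) (δ : ℝ) : Prop :=
  P.η₁ ≤ D.ratio k ω ∧ P.η₂ * δ ≤ ‖D.g k ω‖

open Classical in
/-- Iterate and trust-region radius at the beginning of iteration `k`. -/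
def state : ℕ → Ω → E n × ℝ
  | 0, _ => (x₀, P.δ₀)
  | k + 1, ω =>
    if D.Accept P k ω (state k ω).2 then
      ((state k ω).1 + mulE (D.Q k ω) (D.s k ω), min (P.γ * (state k ω).2) P.δmax)
    else ((state k ω).1, P.γ⁻¹ * (state k ω).2)

/-- The random iterate `x_k`. -/
def x (k : ℕ) (ω : Ω) : E n := (D.state P x₀ k ω).1

/-- The random trust-region radius `δ_k`. -/
def δ (k : ℕ) (ω : Ω) : ℝ := (D.state P x₀ k ω).2

/-- The σ-algebra generated by the entries of `Q k`. -/
def sigmaQ (k : ℕ) : MeasurableSpace Ω :=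
  ⨆ i : Fin n, ⨆ j : Fin p, MeasurableSpace.comap (fun ω => D.Q k ω i j) inferInstance

/-- The σ-algebra generated by the random model of iteration `k`, through its coefficients. -/
def sigmaModel (k : ℕ) : MeasurableSpace Ω :=
  MeasurableSpace.comap (D.c k) inferInstance ⊔ MeasurableSpace.comap (D.g k) inferInstance ⊔
    ⨆ i : Fin p, ⨆ j : Fin p, MeasurableSpace.comap (fun ω => D.H k ω i j) inferInstance

/-- The σ-algebra generated by the two estimates of iteration `k`. -/
def sigmaEst (k : ℕ) : MeasurableSpace Ω :=
  MeasurableSpace.comap (D.f0 k) inferInstance ⊔ MeasurableSpace.comap (D.fs k) inferInstance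

/-- `F_{k-1}`: generated by the estimates, models and matrices of the iterations `0, …, k - 1`;
trivial for `k = 0`, the starting point being deterministic. -/
def past (k : ℕ) : MeasurableSpace Ω :=
  ⨆ l : Fin k, D.sigmaEst l ⊔ D.sigmaModel l ⊔ D.sigmaQ l

/-- `F_{k-1}^Q`: the past together with the matrix `Q k`. -/
def pastQ (k : ℕ) : MeasurableSpace Ω := D.past k ⊔ D.sigmaQ k

/-- `F_{k-1}^{m,Q}`: the past together with the matrix `Q k` and the model of iteration `k`. -/
def pastMQ (k : ℕ) : MeasurableSpace Ω := D.pastQ k ⊔ D.sigmaModel k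

/-- The region `⋃ k, {x_k + Q_k s : ‖s‖ ≤ δmax}` considered by a realization of the run. -/
def region (ω : Ω) : Set (E n) :=
  ⋃ k : ℕ, {y | ∃ s : E p, ‖s‖ ≤ P.δmax ∧ y = D.x P x₀ k ω + mulE (D.Q k ω) s}

/-- The data form a run of the algorithm: all quantities are random variables, model Hessians are
symmetric, the trial step is determined before the estimates are computed, lies in the trust region,
and achieves a fraction of the Cauchy decrease (`N` is the matrix norm used for the Hessians). -/
structure IsRun [MeasurableSpace Ω] (N : Seminorm ℝ (Matrix (Fin p) (Fin p) ℝ)) : Prop where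
  meas_Q : ∀ k i j, Measurable fun ω => D.Q k ω i j
  meas_c : ∀ k, Measurable (D.c k)
  meas_g : ∀ k, Measurable (D.g k)
  meas_H : ∀ k i j, Measurable fun ω => D.H k ω i j
  meas_f0 : ∀ k, Measurable (D.f0 k)
  meas_fs : ∀ k, Measurable (D.fs k)
  meas_s : ∀ k, Measurable[D.pastMQ k] (D.s k)
  symm_H : ∀ k ω, (D.H k ω).IsSymm
  norm_s : ∀ k ω, ‖D.s k ω‖ ≤ D.δ P x₀ k ω
  cauchy : ∀ k ω, P.κfcd / 2 * ‖D.g k ω‖ *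
      min (D.δ P x₀ k ω) (‖D.g k ω‖ / max (N (D.H k ω)) 1)
    ≤ D.model k ω 0 - D.model k ω (D.s k ω)

/-- The matrices `Q k` are `(1 - βQ)`-probabilistically `αQ`-well aligned. -/
def WellAligned {mΩ : MeasurableSpace Ω} (μ : Measure Ω) (αQ βQ : ℝ) : Prop :=
  ∀ (k : ℕ) (v : Ω → E n), Measurable[D.past k] v →
    CondProbGE μ (D.past k) {ω | αQ * ‖v ω‖ ≤ ‖mulE (D.Q k ω).transpose (v ω)‖} (1 - βQ)

/-- The models are `βm`-probabilistically fully linear. -/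
def ProbFullyLinear {mΩ : MeasurableSpace Ω} (μ : Measure Ω) (κef κeg βm : ℝ) : Prop :=
  ∀ k : ℕ, CondProbGE μ (D.pastQ k)
    {ω | FullyLinear κef κeg f (D.Q k ω) (D.x P x₀ k ω) (D.δ P x₀ k ω) (D.model k ω)} βm

/-- The estimates are `βf`-probabilistically `εf`-accurate. -/
def ProbAccurate {mΩ : MeasurableSpace Ω} (μ : Measure Ω) (εf βf : ℝ) : Prop :=
  ∀ k : ℕ, CondProbGE μ (D.pastMQ k)
    {ω | Accurate εf f (D.x P x₀ k ω) (D.x P x₀ k ω + mulE (D.Q k ω) (D.s k ω))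
      (D.δ P x₀ k ω) (D.f0 k ω) (D.fs k ω)} βf

/-- The first iteration with gradient norm at most `ε` (`⊤` if there is none). -/
def τ (ε : ℝ) (ω : Ω) : ℕ∞ :=
  ⨅ k : ℕ, ⨅ _ : ‖gradient f (D.x P x₀ k ω)‖ ≤ ε, (k : ℕ∞)

end Data

end STARS

end

open MeasureTheory ProbabilityTheory
open scoped NNReal ENNReal

noncomputable section

namespace STARS

/-! ### Euclidean matrix algebra, quadratic models and a first-order upper bound. -/

section Matrices

variable {m n : ℕ}

/-! The proof combines two potentials, each controlling one regime of the radius.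

The merit value `φ` falls in expectation by at least `ϱ δ ^ 2` in every iteration, given the past
(`setIntegral_merit_change_le`). To see this, compare the gradient pulled back to the subspace, `Qᵀ
∇f`, with `ζ δ`. If it is small, accurate estimates alone force a decrease, and `βf` is so close to
one that bad estimates cannot undo it. If it is large, an accurate model makes the trial point a
genuine descent, accurate estimates make the iteration accepted, and the product `βf βm` outweighs
the remaining cases. Alignment of `Q` plays no role in this part.

The merit decrease is useless when the radius is tiny. Fix a threshold `d` proportional to the
target accuracy. While the gradient exceeds that accuracy and `γ δ ≤ d`, an iteration with aligned
matrix, accurate model and accurate estimates is accepted, and the radius grows by `γ`. This has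
conditional probability at least `βtilde > 1 / 2`, so the logarithm of the radius, cut off at zero,
drifts upward (`setIntegral_logGap_change_ge`).

In `lintegral_τ_le` the combination `a φ - c logGap` is nonnegative and loses at least one in
expectation per iteration before the hitting time: large radii are paid for by `φ`, small ones by
`logGap`. Telescoping (`tsum_measure_le_of_drift`) bounds the sum of the tail probabilities by the
initial value, which is `a φ_0` because `logGap` starts at zero. As `a` scales like `d ^ (-2)`, this
is the claimed rate. -/

lemma mulE_eq (A : Matrix (Fin m) (Fin n) ℝ) (v : E n) :
    mulE A v = Matrix.toLpLin 2 2 A v := rfl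

@[simp] lemma mulE_zero (A : Matrix (Fin m) (Fin n) ℝ) : mulE A 0 = 0 := by
  rw [mulE_eq, map_zero]

lemma mulE_smul (A : Matrix (Fin m) (Fin n) ℝ) (t : ℝ) (v : E n) :
    mulE A (t • v) = t • mulE A v := by
  rw [mulE_eq, map_smul, mulE_eq]

lemma mulE_apply (A : Matrix (Fin m) (Fin n) ℝ) (v : E n) (i : Fin m) :
    mulE A v i = ∑ j, A i j * v j := rfl

lemma inner_mulE_transpose (A : Matrix (Fin m) (Fin n) ℝ) (v : E m) (w : E n) :
    inner ℝ (mulE A.transpose v) w = inner ℝ v (mulE A w) := by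
  simp only [PiLp.inner_apply, mulE_apply, RCLike.inner_apply, conj_trivial, Finset.mul_sum,
    Finset.sum_mul, Matrix.transpose_apply]
  rw [Finset.sum_comm]
  refine Finset.sum_congr rfl fun i _ => Finset.sum_congr rfl fun j _ => by ring

/-- Consistency controls `A` only; the transpose inherits the bound by duality, from `‖Aᵀ v‖ ^ 2 =
⟪v, A Aᵀ v⟫`. -/
lemma norm_mulE_transpose_le {N : Seminorm ℝ (Matrix (Fin m) (Fin n) ℝ)} (hN : Consistent N)
    {A : Matrix (Fin m) (Fin n) ℝ} {q : ℝ} (hA : N A ≤ q) (v : E m) :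
    ‖mulE A.transpose v‖ ≤ q * ‖v‖ := by
  have hq : 0 ≤ q := (apply_nonneg N A).trans hA
  by_cases h0 : ‖mulE A.transpose v‖ = 0
  · rw [h0]; positivity
  have h1 : ‖mulE A.transpose v‖ * ‖mulE A.transpose v‖ ≤
      q * ‖v‖ * ‖mulE A.transpose v‖ := by
    calc ‖mulE A.transpose v‖ * ‖mulE A.transpose v‖
        = inner ℝ v (mulE A (mulE A.transpose v)) := by
          rw [← inner_mulE_transpose, real_inner_self_eq_norm_mul_norm]
      _ ≤ ‖v‖ * ‖mulE A (mulE A.transpose v)‖ := real_inner_le_norm _ _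
      _ ≤ ‖v‖ * (q * ‖mulE A.transpose v‖) := by
          gcongr
          exact (hN _ _).trans (by gcongr)
      _ = _ := by ring
  exact le_of_mul_le_mul_right h1 (lt_of_le_of_ne (norm_nonneg _) (Ne.symm h0))

@[simp] lemma quadModel_zero (c : ℝ) (g : E n) (H : Matrix (Fin n) (Fin n) ℝ) :
    quadModel c g H 0 = c := by
  simp [quadModel]

lemma gradient_quadModel_zero (c : ℝ) (g : E n) (H : Matrix (Fin n) (Fin n) ℝ) :
    gradient (quadModel c g H) 0 = g := by
  apply HasGradientAt.gradient
  rw [hasGradientAt_iff_hasFDerivAt]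
  let T : E n →L[ℝ] E n := LinearMap.toContinuousLinearMap (Matrix.toLpLin 2 2 H)
  have h1 : HasFDerivAt (fun s : E n => inner ℝ g s) (InnerProductSpace.toDual ℝ (E n) g) 0 :=
    (InnerProductSpace.toDual ℝ (E n) g).hasFDerivAt
  have h2 := ((hasFDerivAt_id (𝕜 := ℝ) (0 : E n)).inner ℝ (T.hasFDerivAt (x := 0))).const_mul
    (1 / 2 : ℝ)
  have h3 := (h1.const_add c).add h2
  refine h3.congr_fderiv ?_
  ext v
  simp

end Matrices

/-- A first-order upper bound for a function with Lipschitz gradient along a segment. -/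
lemma le_add_inner_add_of_lipschitz_gradient {n : ℕ} {f : E n → ℝ} (hf : ContDiff ℝ 1 f)
    {S : Set (E n)} {L : ℝ≥0} (hL : LipschitzOnWith L (gradient f) S) {x d : E n}
    (hS : ∀ t ∈ Set.Icc (0 : ℝ) 1, x + t • d ∈ S) :
    f (x + d) ≤ f x + inner ℝ (gradient f x) d + L * ‖d‖ ^ 2 := by
  have hd : Differentiable ℝ f := hf.differentiable (by norm_num)
  have hder : ∀ t : ℝ, HasDerivAt (fun t : ℝ => f (x + t • d))
      (inner ℝ (gradient f (x + t • d)) d) t := by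
    intro t
    have h1 : HasDerivAt (fun t : ℝ => x + t • d) d t := by
      simpa using ((hasDerivAt_id t).smul_const d).const_add x
    have h2 := (hd (x + t • d)).hasGradientAt.hasFDerivAt.comp_hasDerivAt t h1
    rw [InnerProductSpace.toDual_apply_apply] at h2
    exact h2
  -- The mean value theorem gives the constant `L` instead of the sharp `L / 2`; the factor `3 / 2`
  -- in `C₃` leaves room for this.
  obtain ⟨t, ht, hst⟩ := exists_hasDerivAt_eq_slope (fun t : ℝ => f (x + t • d))
    (fun t => inner ℝ (gradient f (x + t • d)) d) one_pos
    (fun t _ => (hder t).continuousAt.continuousWithinAt) (fun t _ => hder t)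
  have hx : x ∈ S := by simpa using hS 0 (by simp)
  have hxt := hS t ⟨ht.1.le, ht.2.le⟩
  have h1 : ‖gradient f (x + t • d) - gradient f x‖ ≤ L * ‖d‖ := by
    have := hL.dist_le_mul _ hxt _ hx
    rw [dist_eq_norm, dist_eq_norm, add_sub_cancel_left, norm_smul, Real.norm_eq_abs,
      abs_of_pos ht.1] at this
    refine this.trans ?_
    have : t * ‖d‖ ≤ 1 * ‖d‖ := by gcongr; exact ht.2.le
    rw [one_mul] at this
    gcongr
  have h2 : inner ℝ (gradient f (x + t • d) - gradient f x) d ≤ L * ‖d‖ * ‖d‖ :=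
    (real_inner_le_norm _ _).trans (by gcongr)
  rw [inner_sub_left] at h2
  simp only [one_smul, zero_smul, add_zero, sub_zero, div_one] at hst
  rw [pow_two]
  linarith

/-! ### Consequences of the inequalities between the constants. -/

namespace Params.Admissible

variable {P : Params} (hP : P.Admissible)
include hP

lemma γ_pos : 0 < P.γ := zero_lt_one.trans hP.γ_gt

lemma C₁_pos : 0 < P.C₁ := by
  have := hP.κfcd_pos; have := hP.κeg_pos; have := hP.κef_pos
  have h : 0 < P.κh := zero_lt_one.trans_le hP.κh_ge
  unfold Params.C₁
  exact mul_pos (by positivity) (lt_max_of_lt_left (by positivity))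

lemma C₂_pos : 0 < P.C₂ := by
  have h := lt_of_lt_of_le hP.εf_lt (min_le_right _ _)
  unfold Params.C₂
  linarith

lemma one_le_C₃ : 1 ≤ P.C₃ := by
  have := hP.ζ_pos
  unfold Params.C₃
  have : 0 ≤ 3 * (P.Lg : ℝ) / (2 * P.ζ) * P.Qmax ^ 2 := by positivity
  linarith

lemma δ₀_le_δmax : P.δ₀ ≤ P.δmax := by
  unfold Params.δmax
  exact le_mul_of_one_le_left hP.δ₀_pos.le (one_le_pow₀ hP.γ_gt.le)

lemma ν_weight : 8 * P.γ ^ 2 * (1 - P.ν) ≤ P.ν * min P.C₂ (P.ζ * P.C₁) := by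
  have h := hP.ν_ge
  have h1 : 0 < min P.C₂ (P.ζ * P.C₁) := lt_min hP.C₂_pos (mul_pos hP.ζ_pos hP.C₁_pos)
  have h2 := hP.ν_lt
  rwa [div_le_div_iff₀ h1 (by linarith)] at h

lemma ν_weight₂ : 8 * P.γ ^ 2 * (1 - P.ν) ≤ P.ν * P.C₂ :=
  hP.ν_weight.trans (mul_le_mul_of_nonneg_left (min_le_left _ _) hP.ν_pos.le)

lemma ν_weight₁ : 8 * P.γ ^ 2 * (1 - P.ν) ≤ P.ν * (P.ζ * P.C₁) :=
  hP.ν_weight.trans (mul_le_mul_of_nonneg_left (min_le_right _ _) hP.ν_pos.le)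

/-- The balance for large pulled back gradients: `C₃` measures the worst increase, `C₁` the
guaranteed decrease. -/
lemma C₃_mul_le :
    P.C₃ * ((1 - P.βf) + (1 - P.βm)) ≤ P.C₁ * (P.βf * P.βm - 1 / 2) := by
  have h := hP.prob_ge
  have h1 := hP.βf_lt
  have h2 := hP.βm_lt
  rw [div_le_div_iff₀ hP.C₁_pos (by linarith)] at h
  linarith

lemma half_lt_βtilde : 1 / 2 < P.βtilde := by
  have h := hP.βQ_lt
  have h1 : 0 < P.βf * P.βm := mul_pos hP.βf_pos hP.βm_pos
  have h2 : 1 / (2 * P.βf * P.βm) < 1 - P.βQ := by linarith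
  rw [div_lt_iff₀ (by linarith)] at h2
  unfold Params.βtilde
  linarith

/-- The decrease of the weighted squared radius in a rejected iteration, as a share of `δ ^ 2`. -/
lemma shrink_pos : 0 < (1 - P.ν) * (1 - 1 / P.γ ^ 2) := by
  have h1 := hP.ν_lt
  have h2 : 1 / P.γ ^ 2 < 1 := by
    rw [div_lt_one (pow_pos hP.γ_pos 2)]
    exact one_lt_pow₀ hP.γ_gt (by norm_num)
  exact mul_pos (by linarith) (by linarith)

lemma ϱ_pos : 0 < P.ϱ := by
  have := mul_pos hP.βf_pos hP.shrink_pos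
  unfold Params.ϱ
  linarith

/-- The balance for small pulled back gradients: the expected harm of bad estimates uses up at most
half of the expected decrease, and the other half is `ϱ δ ^ 2`. -/
lemma βf_weight :
    2 * (1 - P.βf) * (P.ν * P.C₃ * P.ζ + (1 - P.ν) * (P.γ ^ 2 - 1)) ≤
      P.βf * ((1 - P.ν) * (1 - 1 / P.γ ^ 2)) := by
  have h := hP.βf_ge
  have h1 : 0 < 1 - P.βf := by linarith [hP.βf_lt]
  have h2 : 0 < P.γ ^ 2 - 1 := by
    have : 1 < P.γ ^ 2 := one_lt_pow₀ hP.γ_gt (by norm_num)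
    linarith
  have h3 : 0 < 1 - P.ν := by linarith [hP.ν_lt]
  have h4 := hP.γ_pos
  rw [le_div_iff₀ h1] at h
  have h5 := mul_le_mul_of_nonneg_left h hP.shrink_pos.le
  refine le_trans (le_of_eq ?_) (h5.trans (le_of_eq (by ring)))
  field_simp

lemma ξhat_pos : 0 < P.ξhat := by
  have := hP.αQ_pos; have := hP.κeg_pos
  have h : 0 < P.κh := zero_lt_one.trans_le hP.κh_ge
  unfold Params.ξhat
  exact mul_pos (by positivity) (lt_max_of_lt_left (by positivity))

/-- The lower bound on the model gradient, relative to the radius, that makes an accurate iteration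
successful. -/
lemma κeg_add_le_αQ_mul_ξhat :
    P.κeg + max P.η₂ (max P.κh (8 * P.κef / (P.κfcd * (1 - P.η₁)))) ≤ P.αQ * P.ξhat := by
  have h := hP.αQ_pos
  unfold Params.ξhat
  rw [← mul_assoc, mul_one_div_cancel h.ne', one_mul, ← max_add_add_left, ← max_add_add_left]
  refine max_le ?_ (max_le ?_ ?_)
  · exact le_max_of_le_right (le_max_of_le_left (by linarith))
  · exact le_max_of_le_left (by linarith)
  · exact le_max_of_le_right (le_max_of_le_right (by linarith))

end Params.Admissible

/-! ### Pathwise behaviour of iterates, radii and merit values. -/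

namespace Data

variable {n p : ℕ} {Ω : Type*}

/-- The gradient of `f` at the current iterate, pulled back to the subspace of the iteration. -/
def pullGrad (D : Data n p Ω) (P : Params) (f : E n → ℝ) (x₀ : E n) (k : ℕ) (ω : Ω) : E p :=
  mulE (D.Q k ω).transpose (gradient f (D.x P x₀ k ω))

/-- The trial point `x_k + Q_k s_k`. -/
def trial (D : Data n p Ω) (P : Params) (x₀ : E n) (k : ℕ) (ω : Ω) : E n :=
  D.x P x₀ k ω + mulE (D.Q k ω) (D.s k ω)

/-- The merit function along the run. -/
def φ (D : Data n p Ω) (P : Params) (f : E n → ℝ) (x₀ : E n) (k : ℕ) (ω : Ω) : ℝ :=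
  P.merit f (D.x P x₀ k ω) (D.δ P x₀ k ω)

/-- The realizations for which the model of iteration `k` is accurate at the origin and at the trial
step: the part of full linearity that is visible once the model is known. -/
def modelGood (D : Data n p Ω) (P : Params) (f : E n → ℝ) (x₀ : E n) (k : ℕ) : Set Ω :=
  {ω | |f (D.x P x₀ k ω) - D.c k ω| ≤ P.κef * D.δ P x₀ k ω ^ 2 ∧
    |f (D.trial P x₀ k ω) - D.model k ω (D.s k ω)| ≤ P.κef * D.δ P x₀ k ω ^ 2 ∧
    ‖D.pullGrad P f x₀ k ω - D.g k ω‖ ≤ P.κeg * D.δ P x₀ k ω}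

/-- The realizations for which the estimates of iteration `k` are accurate. -/
def estGood (D : Data n p Ω) (P : Params) (f : E n → ℝ) (x₀ : E n) (k : ℕ) : Set Ω :=
  {ω | Accurate P.εf f (D.x P x₀ k ω) (D.trial P x₀ k ω) (D.δ P x₀ k ω) (D.f0 k ω) (D.fs k ω)}

/-- The acceptance event of iteration `k`. -/
def accepted (D : Data n p Ω) (P : Params) (x₀ : E n) (k : ℕ) : Set Ω :=
  {ω | D.Accept P k ω (D.δ P x₀ k ω)}

variable {D : Data n p Ω} {P : Params} {f : E n → ℝ} {x₀ : E n} {k : ℕ} {ω : Ω}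

lemma x_zero : D.x P x₀ 0 ω = x₀ := rfl

lemma δ_zero : D.δ P x₀ 0 ω = P.δ₀ := rfl

lemma x_succ_of_accepted (h : ω ∈ D.accepted P x₀ k) :
    D.x P x₀ (k + 1) ω = D.trial P x₀ k ω := by
  have h' : D.Accept P k ω (D.state P x₀ k ω).2 := h
  simp only [x, trial, state, if_pos h']

lemma δ_succ_of_accepted (h : ω ∈ D.accepted P x₀ k) :
    D.δ P x₀ (k + 1) ω = min (P.γ * D.δ P x₀ k ω) P.δmax := by
  have h' : D.Accept P k ω (D.state P x₀ k ω).2 := h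
  simp only [δ, state, if_pos h']

lemma x_succ_of_not_accepted (h : ω ∉ D.accepted P x₀ k) :
    D.x P x₀ (k + 1) ω = D.x P x₀ k ω := by
  have h' : ¬ D.Accept P k ω (D.state P x₀ k ω).2 := h
  simp only [x, state, if_neg h']

lemma δ_succ_of_not_accepted (h : ω ∉ D.accepted P x₀ k) :
    D.δ P x₀ (k + 1) ω = P.γ⁻¹ * D.δ P x₀ k ω := by
  have h' : ¬ D.Accept P k ω (D.state P x₀ k ω).2 := h
  simp only [δ, state, if_neg h']

lemma norm_g_ge {a : ℝ} (hω : ω ∈ D.modelGood P f x₀ k)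
    (h : (P.κeg + a) * D.δ P x₀ k ω ≤ ‖D.pullGrad P f x₀ k ω‖) :
    a * D.δ P x₀ k ω ≤ ‖D.g k ω‖ := by
  have h1 := norm_sub_norm_le (D.pullGrad P f x₀ k ω) (D.g k ω)
  linarith [hω.2.2]

section Radius

variable (hP : P.Admissible)
include hP

lemma δ_bounds (k : ℕ) (ω : Ω) : 0 < D.δ P x₀ k ω ∧ D.δ P x₀ k ω ≤ P.δmax := by
  have h0 := hP.γ_pos
  have hm : 0 < P.δmax := hP.δ₀_pos.trans_le hP.δ₀_le_δmax
  induction k with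
  | zero => exact ⟨hP.δ₀_pos, hP.δ₀_le_δmax⟩
  | succ k ih =>
    by_cases h : ω ∈ D.accepted P x₀ k
    · rw [δ_succ_of_accepted h]
      exact ⟨lt_min (mul_pos h0 ih.1) hm, min_le_right _ _⟩
    · rw [δ_succ_of_not_accepted h]
      refine ⟨mul_pos (inv_pos.2 h0) ih.1, le_trans ?_ ih.2⟩
      exact mul_le_of_le_one_left ih.1.le (inv_le_one_of_one_le₀ hP.γ_gt.le)

lemma δ_pos (k : ℕ) (ω : Ω) : 0 < D.δ P x₀ k ω := (δ_bounds hP k ω).1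

lemma δ_le_δmax (k : ℕ) (ω : Ω) : D.δ P x₀ k ω ≤ P.δmax := (δ_bounds hP k ω).2

lemma inv_mul_δ_le_δ_succ (k : ℕ) (ω : Ω) :
    P.γ⁻¹ * D.δ P x₀ k ω ≤ D.δ P x₀ (k + 1) ω := by
  by_cases h : ω ∈ D.accepted P x₀ k
  · rw [δ_succ_of_accepted h]
    have h1 := δ_pos (D := D) (x₀ := x₀) hP k ω
    have h2 : P.γ⁻¹ * D.δ P x₀ k ω ≤ 1 * D.δ P x₀ k ω := by
      gcongr
      exact inv_le_one_of_one_le₀ hP.γ_gt.le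
    have h3 : 1 * D.δ P x₀ k ω ≤ P.γ * D.δ P x₀ k ω := by
      gcongr
      exact hP.γ_gt.le
    refine le_min (h2.trans h3) ((h2.trans_eq (one_mul _)).trans (δ_le_δmax hP k ω))
  · rw [δ_succ_of_not_accepted h]

lemma merit_succ_of_not_accepted (h : ω ∉ D.accepted P x₀ k) :
    D.φ P f x₀ (k + 1) ω - D.φ P f x₀ k ω =
      -((1 - P.ν) * (1 - 1 / P.γ ^ 2) * D.δ P x₀ k ω ^ 2) := by
  have := hP.γ_pos
  unfold φ Params.merit
  rw [x_succ_of_not_accepted h, δ_succ_of_not_accepted h]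
  field_simp
  ring

lemma merit_succ_le_of_accepted (h : ω ∈ D.accepted P x₀ k) :
    D.φ P f x₀ (k + 1) ω - D.φ P f x₀ k ω ≤
      P.ν * (f (D.trial P x₀ k ω) - f (D.x P x₀ k ω)) +
        (1 - P.ν) * (P.γ ^ 2 - 1) * D.δ P x₀ k ω ^ 2 := by
  unfold φ Params.merit
  rw [x_succ_of_accepted h, δ_succ_of_accepted h]
  have h1 : 0 < min (P.γ * D.δ P x₀ k ω) P.δmax :=
    lt_min (mul_pos hP.γ_pos (δ_pos hP k ω)) (hP.δ₀_pos.trans_le hP.δ₀_le_δmax)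
  have h2 : min (P.γ * D.δ P x₀ k ω) P.δmax ^ 2 ≤ (P.γ * D.δ P x₀ k ω) ^ 2 :=
    pow_le_pow_left₀ h1.le (min_le_left _ _) 2
  have h3 : 0 ≤ 1 - P.ν := by linarith [hP.ν_lt]
  have h4 := mul_le_mul_of_nonneg_left h2 h3
  nlinarith

/-- The choice of `ν` makes the gain in `f` worth `8 γ ^ 2 (1 - ν) δ ^ 2`, while the growth of the
radius costs less than one eighth of it. The surplus of seven absorbs the error terms of the
expectation estimate. -/
lemma gain_nonneg (hζ : P.ζ * D.δ P x₀ k ω ≤ ‖D.pullGrad P f x₀ k ω‖) :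
    7 * P.γ ^ 2 * (1 - P.ν) * D.δ P x₀ k ω ^ 2 ≤
      P.ν * P.C₁ * ‖D.pullGrad P f x₀ k ω‖ * D.δ P x₀ k ω -
        (1 - P.ν) * (P.γ ^ 2 - 1) * D.δ P x₀ k ω ^ 2 := by
  have hδ := δ_pos (D := D) (x₀ := x₀) hP k ω
  have h1 : 0 ≤ P.ν * P.C₁ * D.δ P x₀ k ω :=
    mul_nonneg (mul_nonneg hP.ν_pos.le hP.C₁_pos.le) hδ.le
  have h2 := mul_le_mul_of_nonneg_left hζ h1
  have h3 := mul_le_mul_of_nonneg_right hP.ν_weight₁ (sq_nonneg (D.δ P x₀ k ω))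
  have h4 : 0 ≤ (1 - P.ν) * D.δ P x₀ k ω ^ 2 :=
    mul_nonneg (by linarith [hP.ν_lt]) (sq_nonneg _)
  nlinarith

end Radius

/-! ### Pathwise change of the objective at the trial point. -/

section Step

variable [MeasurableSpace Ω] {NH : Seminorm ℝ (Matrix (Fin p) (Fin p) ℝ)}
  {NQ : Seminorm ℝ (Matrix (Fin n) (Fin p) ℝ)}

lemma modelGood_of_fullyLinear (hP : P.Admissible) (hrun : D.IsRun P x₀ NH)
    (h : FullyLinear P.κef P.κeg f (D.Q k ω) (D.x P x₀ k ω) (D.δ P x₀ k ω) (D.model k ω)) :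
    ω ∈ D.modelGood P f x₀ k := by
  have h0 := h 0 (by simpa using (δ_pos hP k ω).le)
  have hs := h (D.s k ω) (hrun.norm_s k ω)
  simp only [mulE_zero, add_zero, model, quadModel_zero, gradient_quadModel_zero] at h0
  exact ⟨h0.1, hs.1, h0.2⟩

lemma mem_region (hP : P.Admissible) (hrun : D.IsRun P x₀ NH) {t : ℝ}
    (ht : t ∈ Set.Icc (0 : ℝ) 1) :
    D.x P x₀ k ω + t • mulE (D.Q k ω) (D.s k ω) ∈ D.region P x₀ ω := by
  refine Set.mem_iUnion.2 ⟨k, t • D.s k ω, ?_, by rw [mulE_smul]⟩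
  rw [norm_smul, Real.norm_eq_abs, abs_of_nonneg ht.1]
  exact (mul_le_of_le_one_left (norm_nonneg _) ht.2).trans
    ((hrun.norm_s k ω).trans (δ_le_δmax hP k ω))

lemma x_mem_region (hP : P.Admissible) (hrun : D.IsRun P x₀ NH) :
    D.x P x₀ k ω ∈ D.region P x₀ ω := by
  simpa using mem_region (k := k) (ω := ω) hP hrun (t := 0) (by simp)

lemma norm_mulE_s_le (hP : P.Admissible) (hrun : D.IsRun P x₀ NH) (hNQ : Consistent NQ)
    (hQ : NQ (D.Q k ω) ≤ P.Qmax) :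
    ‖mulE (D.Q k ω) (D.s k ω)‖ ≤ P.Qmax * D.δ P x₀ k ω := by
  have := hP.Qmax_pos
  exact (hNQ _ _).trans (mul_le_mul hQ (hrun.norm_s k ω) (norm_nonneg _) this.le)

/-- The most that the objective can increase in an iteration. -/
lemma f_trial_le (hP : P.Admissible) (hrun : D.IsRun P x₀ NH) (hf : ContDiff ℝ 1 f)
    (hL : LipschitzOnWith P.Lg (gradient f) (D.region P x₀ ω)) (hNQ : Consistent NQ)
    (hQ : NQ (D.Q k ω) ≤ P.Qmax) :
    f (D.trial P x₀ k ω) - f (D.x P x₀ k ω) ≤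
      ‖D.pullGrad P f x₀ k ω‖ * D.δ P x₀ k ω + P.Lg * P.Qmax ^ 2 * D.δ P x₀ k ω ^ 2 := by
  have h1 := le_add_inner_add_of_lipschitz_gradient hf hL
    (fun t ht => mem_region (k := k) (ω := ω) hP hrun ht)
  -- Moving `Q` across the inner product leaves only the pulled back gradient, so its component
  -- invisible to the subspace does not enter.
  rw [← inner_mulE_transpose] at h1
  have h2 : inner ℝ (D.pullGrad P f x₀ k ω) (D.s k ω) ≤
      ‖D.pullGrad P f x₀ k ω‖ * D.δ P x₀ k ω :=
    (real_inner_le_norm _ _).trans (by gcongr; exact hrun.norm_s k ω)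
  have h3 : P.Lg * ‖mulE (D.Q k ω) (D.s k ω)‖ ^ 2 ≤ P.Lg * (P.Qmax * D.δ P x₀ k ω) ^ 2 := by
    gcongr
    exact norm_mulE_s_le hP hrun hNQ hQ
  unfold pullGrad at h2
  unfold trial pullGrad
  rw [mul_pow, ← mul_assoc] at h3
  linarith

lemma model_decrease_ge (hP : P.Admissible) (hrun : D.IsRun P x₀ NH)
    (hH : NH (D.H k ω) ≤ P.κh) :
    P.κfcd / 2 * ‖D.g k ω‖ * min (D.δ P x₀ k ω) (‖D.g k ω‖ / P.κh) ≤
      D.c k ω - D.model k ω (D.s k ω) := by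
  have h := hrun.cauchy k ω
  have h0 : D.model k ω 0 = D.c k ω := quadModel_zero _ _ _
  rw [h0] at h
  refine le_trans ?_ h
  have := hP.κfcd_pos
  gcongr
  exact max_le hH hP.κh_ge

/-- The decrease of the model when its gradient is large compared to the radius. -/
lemma model_decrease_ge_of_κh_le (hP : P.Admissible) (hrun : D.IsRun P x₀ NH)
    (hH : NH (D.H k ω) ≤ P.κh) (hg : P.κh * D.δ P x₀ k ω ≤ ‖D.g k ω‖) :
    P.κfcd / 2 * ‖D.g k ω‖ * D.δ P x₀ k ω ≤ D.c k ω - D.model k ω (D.s k ω) := by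
  have h := model_decrease_ge hP hrun hH
  have hκ : 0 < P.κh := zero_lt_one.trans_le hP.κh_ge
  rwa [min_eq_left ((le_div_iff₀ hκ).2 (by linarith))] at h

/-- An iteration with accurate model and estimates whose radius is small compared to the pulled back
gradient is accepted. -/
lemma mem_accepted (hP : P.Admissible) (hrun : D.IsRun P x₀ NH)
    (hH : NH (D.H k ω) ≤ P.κh) (hI : ω ∈ D.modelGood P f x₀ k) (hJ : ω ∈ D.estGood P f x₀ k)
    (h : (P.κeg + max P.η₂ (max P.κh (8 * P.κef / (P.κfcd * (1 - P.η₁))))) * D.δ P x₀ k ω ≤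
      ‖D.pullGrad P f x₀ k ω‖) :
    ω ∈ D.accepted P x₀ k := by
  have hδ := δ_pos (D := D) (x₀ := x₀) hP k ω
  have hg := norm_g_ge hI h
  have hg1 : P.η₂ * D.δ P x₀ k ω ≤ ‖D.g k ω‖ :=
    le_trans (by gcongr; exact le_max_left _ _) hg
  have hg2 : P.κh * D.δ P x₀ k ω ≤ ‖D.g k ω‖ :=
    le_trans (by gcongr; exact le_max_of_le_right (le_max_left _ _)) hg
  have hg3 : 8 * P.κef / (P.κfcd * (1 - P.η₁)) * D.δ P x₀ k ω ≤ ‖D.g k ω‖ :=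
    le_trans (by gcongr; exact le_max_of_le_right (le_max_right _ _)) hg
  have hpred := model_decrease_ge_of_κh_le hP hrun hH hg2
  have hη : 0 < 1 - P.η₁ := by linarith [hP.η₁_lt]
  have hκ := hP.κfcd_pos
  have hgpos : 0 < ‖D.g k ω‖ := (mul_pos hP.η₂_pos hδ).trans_le hg1
  have hpos : 0 < D.c k ω - D.model k ω (D.s k ω) :=
    lt_of_lt_of_le (by positivity) hpred
  have h0 : D.model k ω 0 = D.c k ω := quadModel_zero _ _ _
  refine ⟨?_, hg1⟩
  unfold ratio
  rw [h0, le_div_iff₀ hpos]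
  have hε : P.εf * D.δ P x₀ k ω ^ 2 ≤ P.κef * D.δ P x₀ k ω ^ 2 := by
    gcongr
    exact (hP.εf_lt.trans_le (min_le_left _ _)).le
  have h1 := abs_le.1 hI.1
  have h2 := abs_le.1 hI.2.1
  have h3 := abs_le.1 hJ.1
  have h4 := abs_le.1 hJ.2
  -- Actual and predicted decrease differ by at most four errors of size `κef δ ^ 2`: two from the
  -- model and, since `εf < κef`, two from the estimates.
  have h5 : 4 * P.κef * D.δ P x₀ k ω ^ 2 ≤ (1 - P.η₁) * (P.κfcd / 2 * ‖D.g k ω‖ * D.δ P x₀ k ω) := by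
    rw [div_mul_eq_mul_div, div_le_iff₀ (by positivity)] at hg3
    have := mul_le_mul_of_nonneg_right hg3 hδ.le
    nlinarith
  have h6 := mul_le_mul_of_nonneg_left hpred hη.le
  linarith

/-- A decrease proportional to `‖Qᵀ ∇f‖ δ` at the trial point of an accurate model. -/
lemma f_trial_le_of_modelGood (hP : P.Admissible) (hrun : D.IsRun P x₀ NH)
    (hH : NH (D.H k ω) ≤ P.κh) (hI : ω ∈ D.modelGood P f x₀ k)
    (h : P.ζ * D.δ P x₀ k ω ≤ ‖D.pullGrad P f x₀ k ω‖) :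
    f (D.trial P x₀ k ω) - f (D.x P x₀ k ω) ≤
      -(P.C₁ * ‖D.pullGrad P f x₀ k ω‖ * D.δ P x₀ k ω) := by
  have hδ := δ_pos (D := D) (x₀ := x₀) hP k ω
  have hη : 0 < 1 - P.η₁ := by linarith [hP.η₁_lt]
  have hκ := hP.κfcd_pos
  have hκh : 0 < P.κh := zero_lt_one.trans_le hP.κh_ge
  have hκeg := hP.κeg_pos
  have hκef := hP.κef_pos
  have h' := (mul_le_mul_of_nonneg_right hP.ζ_ge hδ.le).trans h
  have hg := norm_g_ge hI h'
  have hg2 : P.κh * D.δ P x₀ k ω ≤ ‖D.g k ω‖ :=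
    le_trans (by gcongr; exact le_max_of_le_right (le_max_left _ _)) hg
  have hg3 : 8 * P.κef / P.κfcd * D.δ P x₀ k ω ≤ ‖D.g k ω‖ := by
    refine le_trans ?_ hg
    gcongr
    refine le_max_of_le_right (le_max_of_le_right ?_)
    exact div_le_div_of_nonneg_left (by positivity) (by positivity)
      (mul_le_of_le_one_right hκ.le (by linarith [hP.η₁_pos]))
  rw [div_mul_eq_mul_div, div_le_iff₀ hκ] at hg3
  have hpred := model_decrease_ge_of_κh_le hP hrun hH hg2
  have h1 := abs_le.1 hI.1
  have h2 := abs_le.1 hI.2.1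
  have h3 := norm_sub_norm_le (D.pullGrad P f x₀ k ω) (D.g k ω)
  have h4 := hI.2.2
  -- If `‖g‖ ≥ a δ`, then `‖Qᵀ ∇f‖ ≤ ‖g‖ + κeg δ ≤ (1 + κeg / a) ‖g‖`. The two entries of the
  -- maximum are `a = κh` and `a = 8 κef / κfcd`. The second bound also keeps the model errors `2
  -- κef δ ^ 2` below half of the predicted decrease, whence `κfcd / 4` in `C₁`.
  have h5 : max (P.κh / (P.κh + P.κeg)) (8 * P.κef / (8 * P.κef + P.κfcd * P.κeg)) *
      ‖D.pullGrad P f x₀ k ω‖ ≤ ‖D.g k ω‖ := by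
    rw [max_mul_of_nonneg _ _ (norm_nonneg _)]
    refine max_le ?_ ?_
    · rw [div_mul_eq_mul_div, div_le_iff₀ (by positivity)]
      nlinarith
    · rw [div_mul_eq_mul_div, div_le_iff₀ (by positivity)]
      nlinarith
  have h6 : P.C₁ * ‖D.pullGrad P f x₀ k ω‖ ≤ P.κfcd / 4 * ‖D.g k ω‖ := by
    unfold Params.C₁
    rw [mul_assoc]
    gcongr
  have h7 := mul_le_mul_of_nonneg_right h6 hδ.le
  have h8 := mul_le_mul_of_nonneg_right hg3 hδ.le
  nlinarith

/-- An accepted iteration with accurate estimates decreases the objective. -/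
lemma f_trial_le_of_estGood (hP : P.Admissible) (hrun : D.IsRun P x₀ NH)
    (hH : NH (D.H k ω) ≤ P.κh) (hJ : ω ∈ D.estGood P f x₀ k) (h : ω ∈ D.accepted P x₀ k) :
    f (D.trial P x₀ k ω) - f (D.x P x₀ k ω) ≤ -(P.C₂ * D.δ P x₀ k ω ^ 2) := by
  have hδ := δ_pos (D := D) (x₀ := x₀) hP k ω
  have hκ := hP.κfcd_pos
  have hκh : 0 < P.κh := zero_lt_one.trans_le hP.κh_ge
  have hη₂ := hP.η₂_pos
  obtain ⟨hr, hg⟩ := h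
  have hpred := model_decrease_ge hP hrun hH
  have h1 : P.κfcd / 2 * (P.η₂ * D.δ P x₀ k ω) * (min (P.η₂ / P.κh) 1 * D.δ P x₀ k ω) ≤
      D.c k ω - D.model k ω (D.s k ω) := by
    refine le_trans ?_ hpred
    have h2 : min (P.η₂ / P.κh) 1 * D.δ P x₀ k ω ≤
        min (D.δ P x₀ k ω) (‖D.g k ω‖ / P.κh) := by
      refine le_min (mul_le_of_le_one_left hδ.le (min_le_right _ _)) ?_
      calc min (P.η₂ / P.κh) 1 * D.δ P x₀ k ω ≤ P.η₂ / P.κh * D.δ P x₀ k ω := by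
            gcongr
            exact min_le_left _ _
        _ = P.η₂ * D.δ P x₀ k ω / P.κh := by ring
        _ ≤ _ := by gcongr
    have h3 : 0 < min (P.η₂ / P.κh) 1 := lt_min (by positivity) one_pos
    gcongr
  have h3 : 0 < min (P.η₂ / P.κh) 1 := lt_min (by positivity) one_pos
  have hpos : 0 < D.c k ω - D.model k ω (D.s k ω) := lt_of_lt_of_le (by positivity) h1
  have h0 : D.model k ω 0 = D.c k ω := quadModel_zero _ _ _
  unfold ratio at hr
  rw [h0, le_div_iff₀ hpos] at hr
  have h4 := mul_le_mul_of_nonneg_left h1 hP.η₁_pos.le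
  have h5 := abs_le.1 hJ.1
  have h6 := abs_le.1 hJ.2
  unfold Params.C₂
  nlinarith

end Step

/-! ### Pathwise change of the merit function. -/

section Merit

variable [MeasurableSpace Ω] {NH : Seminorm ℝ (Matrix (Fin p) (Fin p) ℝ)}
  {NQ : Seminorm ℝ (Matrix (Fin n) (Fin p) ℝ)}
  (hP : P.Admissible) (hrun : D.IsRun P x₀ NH)
include hP hrun

/-- Rejection gives equality. After acceptance, `ν C₂ ≥ 8 γ ^ 2 (1 - ν)` outweighs the growth of the
radius, so the decrease is no smaller. Accuracy of the model is not needed. -/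
lemma merit_change_of_estGood (hH : NH (D.H k ω) ≤ P.κh) (hJ : ω ∈ D.estGood P f x₀ k) :
    D.φ P f x₀ (k + 1) ω - D.φ P f x₀ k ω ≤
      -((1 - P.ν) * (1 - 1 / P.γ ^ 2) * D.δ P x₀ k ω ^ 2) := by
  by_cases h : ω ∈ D.accepted P x₀ k
  · refine (merit_succ_le_of_accepted hP h).trans ?_
    have h1 := mul_le_mul_of_nonneg_left (f_trial_le_of_estGood hP hrun hH hJ h) hP.ν_pos.le
    have h2 := mul_le_mul_of_nonneg_right hP.ν_weight₂ (sq_nonneg (D.δ P x₀ k ω))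
    have h3 : 0 ≤ 1 / P.γ ^ 2 := by positivity
    have h4 : 0 ≤ (1 - P.ν) * D.δ P x₀ k ω ^ 2 :=
      mul_nonneg (by linarith [hP.ν_lt]) (sq_nonneg _)
    have h5 := mul_nonneg h3 h4
    have h6 := mul_nonneg (sq_nonneg P.γ) h4
    nlinarith
  · exact (merit_succ_of_not_accepted hP h).le

lemma merit_change_of_modelGood (hH : NH (D.H k ω) ≤ P.κh) (hI : ω ∈ D.modelGood P f x₀ k)
    (hζ : P.ζ * D.δ P x₀ k ω ≤ ‖D.pullGrad P f x₀ k ω‖) (h : ω ∈ D.accepted P x₀ k) :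
    D.φ P f x₀ (k + 1) ω - D.φ P f x₀ k ω ≤
      -(P.ν * P.C₁ * ‖D.pullGrad P f x₀ k ω‖ * D.δ P x₀ k ω -
        (1 - P.ν) * (P.γ ^ 2 - 1) * D.δ P x₀ k ω ^ 2) := by
  refine (merit_succ_le_of_accepted hP h).trans ?_
  have h1 := mul_le_mul_of_nonneg_left (f_trial_le_of_modelGood hP hrun hH hI hζ) hP.ν_pos.le
  linarith

/-- With an accurate model and a large pulled back gradient, bad estimates are harmless: acceptance
leads to a descent, and rejection shrinks the radius. -/
lemma merit_change_nonpos_of_modelGood (hH : NH (D.H k ω) ≤ P.κh)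
    (hI : ω ∈ D.modelGood P f x₀ k)
    (hζ : P.ζ * D.δ P x₀ k ω ≤ ‖D.pullGrad P f x₀ k ω‖) :
    D.φ P f x₀ (k + 1) ω - D.φ P f x₀ k ω ≤ 0 := by
  by_cases h : ω ∈ D.accepted P x₀ k
  · have h1 := merit_change_of_modelGood hP hrun hH hI hζ h
    have h2 := gain_nonneg hP hζ
    have h3 : 0 ≤ (1 - P.ν) := by linarith [hP.ν_lt]
    have h4 : 0 ≤ 7 * P.γ ^ 2 * (1 - P.ν) * D.δ P x₀ k ω ^ 2 := by positivity
    linarith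
  · rw [merit_succ_of_not_accepted hP h]
    have := mul_nonneg hP.shrink_pos.le (sq_nonneg (D.δ P x₀ k ω))
    linarith

/-- The most that the merit function can increase in an iteration. -/
lemma merit_change_le (hf : ContDiff ℝ 1 f)
    (hL : LipschitzOnWith P.Lg (gradient f) (D.region P x₀ ω)) (hNQ : Consistent NQ)
    (hQ : NQ (D.Q k ω) ≤ P.Qmax) :
    D.φ P f x₀ (k + 1) ω - D.φ P f x₀ k ω ≤
      P.ν * P.C₃ * max ‖D.pullGrad P f x₀ k ω‖ (P.ζ * D.δ P x₀ k ω) * D.δ P x₀ k ω +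
        (1 - P.ν) * (P.γ ^ 2 - 1) * D.δ P x₀ k ω ^ 2 := by
  have hδ := δ_pos (D := D) (x₀ := x₀) hP k ω
  have hν := hP.ν_pos
  have hζ := hP.ζ_pos
  have hC := hP.one_le_C₃
  have hγ : 0 ≤ P.γ ^ 2 - 1 := by
    linarith [one_lt_pow₀ hP.γ_gt (n := 2) (by norm_num)]
  have h0 : 0 ≤ (1 - P.ν) * (P.γ ^ 2 - 1) * D.δ P x₀ k ω ^ 2 :=
    mul_nonneg (mul_nonneg (by linarith [hP.ν_lt]) hγ) (sq_nonneg _)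
  by_cases h : ω ∈ D.accepted P x₀ k
  · refine (merit_succ_le_of_accepted hP h).trans ?_
    set M := max ‖D.pullGrad P f x₀ k ω‖ (P.ζ * D.δ P x₀ k ω)
    have h1 := f_trial_le hP hrun hf hL hNQ hQ (k := k)
    have h2 : ‖D.pullGrad P f x₀ k ω‖ * D.δ P x₀ k ω ≤ M * D.δ P x₀ k ω := by
      gcongr
      exact le_max_left _ _
    -- Since `ζ δ ≤ M`, the curvature term is absorbed into a multiple of `M δ`; this is the origin
    -- of `C₃ - 1`.
    have h3 : P.Lg * P.Qmax ^ 2 * D.δ P x₀ k ω ^ 2 ≤ (P.C₃ - 1) * M * D.δ P x₀ k ω := by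
      have h4 : P.ζ * D.δ P x₀ k ω ≤ M := le_max_right _ _
      have h5 : (P.C₃ - 1) * P.ζ = 3 / 2 * (P.Lg * P.Qmax ^ 2) := by
        unfold Params.C₃
        field_simp
        ring
      have h6 : 0 ≤ P.Lg * P.Qmax ^ 2 * D.δ P x₀ k ω ^ 2 := by positivity
      have h7 : (P.C₃ - 1) * (P.ζ * D.δ P x₀ k ω) * D.δ P x₀ k ω ≤
          (P.C₃ - 1) * M * D.δ P x₀ k ω :=
        mul_le_mul_of_nonneg_right (mul_le_mul_of_nonneg_left h4 (by linarith)) hδ.le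
      calc P.Lg * P.Qmax ^ 2 * D.δ P x₀ k ω ^ 2
          ≤ 3 / 2 * (P.Lg * P.Qmax ^ 2) * D.δ P x₀ k ω ^ 2 := by linarith
        _ = (P.C₃ - 1) * (P.ζ * D.δ P x₀ k ω) * D.δ P x₀ k ω := by rw [← h5]; ring
        _ ≤ _ := h7
    have h8 : P.ν * (f (D.trial P x₀ k ω) - f (D.x P x₀ k ω)) ≤
        P.ν * (P.C₃ * M * D.δ P x₀ k ω) :=
      mul_le_mul_of_nonneg_left (by linarith) hν.le
    linarith
  · rw [merit_succ_of_not_accepted hP h]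
    have := mul_nonneg hP.shrink_pos.le (sq_nonneg (D.δ P x₀ k ω))
    have : 0 ≤ P.ν * P.C₃ * max ‖D.pullGrad P f x₀ k ω‖ (P.ζ * D.δ P x₀ k ω) *
        D.δ P x₀ k ω := by positivity
    linarith

end Merit

end Data

/-! ### Calculus of conditional probability bounds. -/

namespace CondProbGE

variable {Ω : Type*} {m m₁ m₂ mΩ : MeasurableSpace Ω} {μ : Measure Ω} [IsProbabilityMeasure μ]
  {B B₁ B₂ : Set Ω} {b b₁ b₂ : ℝ}

/-- A positive lower bound on the conditional probability of `B` makes `B` an event. -/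
lemma integrable (h : CondProbGE μ m B b) (hb : 0 < b) :
    Integrable (B.indicator fun _ => (1 : ℝ)) μ := by
  by_contra hI
  unfold CondProbGE at h
  -- The conditional expectation of a non-integrable function is zero by convention, which
  -- contradicts a positive lower bound.
  rw [condExp_of_not_integrable hI] at h
  obtain ⟨ω, hω⟩ := h.exists
  exact absurd hω (by simpa using hb)

/-- Measurability is required of the larger set only; for the smaller one, integrability of the
indicator follows from the positive bound. -/
lemma mono (h : CondProbGE μ m B₁ b) (hb : 0 < b) (hB : B₁ ⊆ B₂)
    (hB₂ : MeasurableSet[mΩ] B₂) : CondProbGE μ m B₂ b := by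
  have h1 : B₁.indicator (fun _ => (1 : ℝ)) ≤ᵐ[μ] B₂.indicator fun _ => (1 : ℝ) :=
    Filter.Eventually.of_forall fun ω =>
      Set.indicator_le_indicator_of_subset hB (fun _ => zero_le_one) ω
  have h2 := condExp_mono (m := m) (h.integrable hb)
    ((integrable_const (1 : ℝ)).indicator hB₂) h1
  filter_upwards [h, h2] with ω ha hb using ha.trans hb

/-- Successive conditional probabilities multiply. -/
lemma inter (hm : m₁ ≤ m₂) (hm₂ : m₂ ≤ mΩ) (h₁ : CondProbGE μ m₁ B₁ b₁)
    (h₂ : CondProbGE μ m₂ B₂ b₂) (hb₂ : 0 < b₂) (hB₁ : MeasurableSet[m₂] B₁) :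
    CondProbGE μ m₁ (B₁ ∩ B₂) (b₁ * b₂) := by
  have hI₂ := h₂.integrable hb₂
  have hI₁ : Integrable (B₁.indicator fun _ => (1 : ℝ)) μ :=
    (integrable_const (1 : ℝ)).indicator (hm₂ _ hB₁)
  have e : (B₁ ∩ B₂).indicator (fun _ => (1 : ℝ)) =
      B₁.indicator (B₂.indicator fun _ => (1 : ℝ)) := by
    rw [Set.indicator_indicator]
  have h3 : μ[(B₁ ∩ B₂).indicator (fun _ => (1 : ℝ)) | m₂] =ᵐ[μ]
      B₁.indicator (μ[B₂.indicator (fun _ => (1 : ℝ)) | m₂]) := by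
    rw [e]
    exact condExp_indicator hI₂ hB₁
  -- Conditioning on `m₂` treats `B₁` as known; the tower property then passes down to `m₁`.
  have h4 : (b₂ • B₁.indicator fun _ => (1 : ℝ)) ≤ᵐ[μ]
      μ[(B₁ ∩ B₂).indicator (fun _ => (1 : ℝ)) | m₂] := by
    filter_upwards [h3, h₂] with ω ha hb
    rw [ha]
    by_cases hω : ω ∈ B₁
    · simpa [hω] using hb
    · simp [hω]
  have h5 := condExp_mono (m := m₁) (hI₁.smul b₂) integrable_condExp h4
  have h6 := condExp_condExp_of_le (μ := μ) (f := (B₁ ∩ B₂).indicator fun _ => (1 : ℝ)) hm hm₂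
  have h7 := condExp_smul (μ := μ) b₂ (B₁.indicator fun _ => (1 : ℝ)) m₁
  filter_upwards [h5, h6, h7, h₁] with ω a5 a6 a7 a1
  rw [← a6]
  refine le_trans ?_ a5
  rw [a7, Pi.smul_apply, smul_eq_mul, mul_comm]
  exact mul_le_mul_of_nonneg_left a1 hb₂.le

lemma univ (hm : m ≤ mΩ) : CondProbGE μ m Set.univ 1 := by
  unfold CondProbGE
  rw [Set.indicator_univ, condExp_const hm]
  simp

lemma of_le (hm : m₁ ≤ m₂) (hm₂ : m₂ ≤ mΩ) (h : CondProbGE μ m₂ B b) (hb : 0 < b) :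
    CondProbGE μ m₁ B b := by
  simpa using (univ (hm.trans hm₂)).inter hm hm₂ h hb MeasurableSet.univ

/-- A lower bound on a conditional probability integrates against nonnegative weights that are
determined by the conditioning. -/
lemma mul_integral_le (hm : m ≤ mΩ) (h : CondProbGE μ m B b) (hb : 0 < b) {w : Ω → ℝ}
    (hw : Measurable[m] w) (hw0 : ∀ ω, 0 ≤ w ω) {K : ℝ} (hK : ∀ ω, w ω ≤ K) :
    b * ∫ ω, w ω ∂μ ≤ ∫ ω, w ω * B.indicator (fun _ => (1 : ℝ)) ω ∂μ := by
  have hI := h.integrable hb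
  have hws : StronglyMeasurable[m] w := hw.stronglyMeasurable
  have hbd : ∀ᵐ ω ∂μ, ‖w ω‖ ≤ K := Filter.Eventually.of_forall fun ω => by
    rw [Real.norm_eq_abs, abs_of_nonneg (hw0 ω)]
    exact hK ω
  have hwI : Integrable w μ :=
    Integrable.of_bound (hws.mono hm).aestronglyMeasurable K hbd
  have h1 := condExp_stronglyMeasurable_mul_of_bound hm hws hI K hbd
  rw [← integral_condExp hm (f := fun ω => w ω * B.indicator (fun _ => (1 : ℝ)) ω),
    ← integral_const_mul]
  refine integral_mono_ae (hwI.const_mul b) integrable_condExp ?_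
  filter_upwards [h1, h] with ω a1 a2
  refine le_trans ?_ a1.ge
  simp only [Pi.mul_apply]
  rw [mul_comm]
  exact mul_le_mul_of_nonneg_left a2 (hw0 ω)

end CondProbGE

lemma continuous_gradient {n : ℕ} {f : E n → ℝ} (hf : ContDiff ℝ 1 f) :
    Continuous (gradient f) :=
  (InnerProductSpace.toDual ℝ (E n)).symm.continuous.comp (hf.continuous_fderiv (by norm_num))

/-! ### Measurability and adaptedness of the run. -/

section Generic

variable {Ω : Type*} {m : MeasurableSpace Ω} {a b : ℕ}

lemma measurable_mulE {A : Ω → Matrix (Fin a) (Fin b) ℝ} {v : Ω → E b}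
    (hA : ∀ i j, Measurable fun ω => A ω i j) (hv : Measurable v) :
    Measurable fun ω => mulE (A ω) (v ω) := by
  refine (PiLp.continuous_toLp 2 _).measurable.comp (measurable_pi_lambda _ fun i => ?_)
  change Measurable fun ω => ∑ j, A ω i j * v ω j
  refine Finset.measurable_fun_sum _ fun j _ => (hA i j).mul ?_
  exact (EuclideanSpace.proj (𝕜 := ℝ) j).continuous.measurable.comp hv

lemma measurable_quadModel {c : Ω → ℝ} {g s : Ω → E a} {H : Ω → Matrix (Fin a) (Fin a) ℝ}
    (hc : Measurable c) (hg : Measurable g) (hH : ∀ i j, Measurable fun ω => H ω i j)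
    (hs : Measurable s) : Measurable fun ω => quadModel (c ω) (g ω) (H ω) (s ω) :=
  (hc.add (hg.inner hs)).add ((hs.inner (measurable_mulE hH hs)).const_mul _)

namespace Data

variable {D : Data a b Ω} {P : Params} {f : E a → ℝ} {x₀ : E a} {k : ℕ}

lemma measurable_trial (hQ : ∀ i j, Measurable fun ω => D.Q k ω i j) (hs : Measurable (D.s k))
    (hx : Measurable (D.x P x₀ k)) : Measurable (D.trial P x₀ k) :=
  hx.add (measurable_mulE hQ hs)

lemma measurable_pullGrad (hf : ContDiff ℝ 1 f) (hQ : ∀ i j, Measurable fun ω => D.Q k ω i j)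
    (hx : Measurable (D.x P x₀ k)) : Measurable (D.pullGrad P f x₀ k) :=
  measurable_mulE (fun i j => hQ j i) ((continuous_gradient hf).measurable.comp hx)

lemma measurable_model (hc : Measurable (D.c k)) (hg : Measurable (D.g k))
    (hH : ∀ i j, Measurable fun ω => D.H k ω i j) (hs : Measurable (D.s k)) :
    Measurable fun ω => D.model k ω (D.s k ω) :=
  measurable_quadModel hc hg hH hs

lemma measurableSet_modelGood (hf : ContDiff ℝ 1 f) (hQ : ∀ i j, Measurable fun ω => D.Q k ω i j)
    (hc : Measurable (D.c k)) (hg : Measurable (D.g k))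
    (hH : ∀ i j, Measurable fun ω => D.H k ω i j) (hs : Measurable (D.s k))
    (hx : Measurable (D.x P x₀ k)) (hδ : Measurable (D.δ P x₀ k)) :
    MeasurableSet (D.modelGood P f x₀ k) := by
  have hfm := hf.continuous.measurable
  have hb := (hδ.pow_const 2).const_mul P.κef
  refine MeasurableSet.inter ?_ (MeasurableSet.inter ?_ ?_)
  · exact measurableSet_le ((hfm.comp hx).sub hc).abs hb
  · exact measurableSet_le
      ((hfm.comp (measurable_trial hQ hs hx)).sub (measurable_model hc hg hH hs)).abs hb
  · exact measurableSet_le ((measurable_pullGrad hf hQ hx).sub hg).norm (hδ.const_mul _)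

lemma measurableSet_accepted (hc : Measurable (D.c k)) (hg : Measurable (D.g k))
    (hH : ∀ i j, Measurable fun ω => D.H k ω i j) (hs : Measurable (D.s k))
    (hf0 : Measurable (D.f0 k)) (hfs : Measurable (D.fs k))
    (hδ : Measurable (D.δ P x₀ k)) : MeasurableSet (D.accepted P x₀ k) := by
  have h0 : Measurable fun ω => D.model k ω 0 := measurable_quadModel hc hg hH measurable_const
  refine MeasurableSet.inter ?_ ?_
  · exact measurableSet_le measurable_const
      ((hf0.sub hfs).div (h0.sub (measurable_model hc hg hH hs)))
  · exact measurableSet_le (hδ.const_mul _) hg.norm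

lemma measurable_x_succ (hA : MeasurableSet (D.accepted P x₀ k))
    (ht : Measurable (D.trial P x₀ k)) (hx : Measurable (D.x P x₀ k)) :
    Measurable (D.x P x₀ (k + 1)) := by
  classical
  have e : D.x P x₀ (k + 1) = fun ω =>
      if ω ∈ D.accepted P x₀ k then D.trial P x₀ k ω else D.x P x₀ k ω := by
    funext ω
    split_ifs with h
    · exact x_succ_of_accepted h
    · exact x_succ_of_not_accepted h
  rw [e]
  exact Measurable.ite hA ht hx

lemma measurable_δ_succ (hA : MeasurableSet (D.accepted P x₀ k))
    (hδ : Measurable (D.δ P x₀ k)) : Measurable (D.δ P x₀ (k + 1)) := by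
  classical
  have e : D.δ P x₀ (k + 1) = fun ω => if ω ∈ D.accepted P x₀ k then
      min (P.γ * D.δ P x₀ k ω) P.δmax else P.γ⁻¹ * D.δ P x₀ k ω := by
    funext ω
    split_ifs with h
    · exact δ_succ_of_accepted h
    · exact δ_succ_of_not_accepted h
  rw [e]
  exact Measurable.ite hA ((hδ.const_mul P.γ).min measurable_const) (hδ.const_mul P.γ⁻¹)

end Data

end Generic

namespace Data

section Sigma

variable {n p : ℕ} {Ω : Type*} (D : Data n p Ω) (k : ℕ)

lemma past_le_pastQ : D.past k ≤ D.pastQ k := le_sup_left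

lemma pastQ_le_pastMQ : D.pastQ k ≤ D.pastMQ k := le_sup_left

lemma past_mono {k l : ℕ} (h : k ≤ l) : D.past k ≤ D.past l :=
  iSup_le fun i => le_iSup_of_le (Fin.castLE h i) le_rfl

lemma last_le_past_succ : D.sigmaEst k ⊔ D.sigmaModel k ⊔ D.sigmaQ k ≤ D.past (k + 1) :=
  le_iSup_of_le (f := fun l : Fin (k + 1) => D.sigmaEst l ⊔ D.sigmaModel l ⊔ D.sigmaQ l)
    (Fin.last k) le_rfl

lemma pastMQ_le_past_succ : D.pastMQ k ≤ D.past (k + 1) := by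
  have h := D.last_le_past_succ k
  refine sup_le (sup_le (D.past_mono (Nat.le_succ k)) (le_trans le_sup_right h)) ?_
  exact le_trans (le_sup_of_le_left le_sup_right) h

variable {D k}

lemma measurable_Q_of_le {m : MeasurableSpace Ω} (h : D.sigmaQ k ≤ m) (i : Fin n) (j : Fin p) :
    Measurable fun ω => D.Q k ω i j :=
  measurable_iff_comap_le.2 (le_trans (le_iSup₂_of_le i j le_rfl) h)

lemma measurable_c_of_le {m : MeasurableSpace Ω} (h : D.sigmaModel k ≤ m) : Measurable (D.c k) :=
  measurable_iff_comap_le.2 (le_trans (le_sup_of_le_left le_sup_left) h)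

lemma measurable_g_of_le {m : MeasurableSpace Ω} (h : D.sigmaModel k ≤ m) : Measurable (D.g k) :=
  measurable_iff_comap_le.2 (le_trans (le_sup_of_le_left le_sup_right) h)

lemma measurable_H_of_le {m : MeasurableSpace Ω} (h : D.sigmaModel k ≤ m) (i j : Fin p) :
    Measurable fun ω => D.H k ω i j :=
  measurable_iff_comap_le.2 (le_trans (le_sup_of_le_right (le_iSup₂_of_le i j le_rfl)) h)

lemma measurable_f0_of_le {m : MeasurableSpace Ω} (h : D.sigmaEst k ≤ m) : Measurable (D.f0 k) :=
  measurable_iff_comap_le.2 (le_trans le_sup_left h)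

lemma measurable_fs_of_le {m : MeasurableSpace Ω} (h : D.sigmaEst k ≤ m) : Measurable (D.fs k) :=
  measurable_iff_comap_le.2 (le_trans le_sup_right h)

end Sigma

section Adapted

variable {n p : ℕ} {Ω : Type*} {D : Data n p Ω} {P : Params} {f : E n → ℝ} {x₀ : E n}
  {mΩ : MeasurableSpace Ω} {NH : Seminorm ℝ (Matrix (Fin p) (Fin p) ℝ)}
  (hrun : D.IsRun P x₀ NH)
include hrun

lemma past_le (k : ℕ) : D.past k ≤ mΩ := by
  refine iSup_le fun l => sup_le (sup_le (sup_le ?_ ?_) (sup_le (sup_le ?_ ?_) ?_)) ?_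
  · exact (hrun.meas_f0 l).comap_le
  · exact (hrun.meas_fs l).comap_le
  · exact (hrun.meas_c l).comap_le
  · exact (hrun.meas_g l).comap_le
  · exact iSup₂_le fun i j => (hrun.meas_H l i j).comap_le
  · exact iSup₂_le fun i j => (hrun.meas_Q l i j).comap_le

lemma pastMQ_le (k : ℕ) : D.pastMQ k ≤ mΩ :=
  (D.pastMQ_le_past_succ k).trans (past_le hrun (k + 1))

lemma pastQ_le (k : ℕ) : D.pastQ k ≤ mΩ := (D.pastQ_le_pastMQ k).trans (pastMQ_le hrun k)

lemma measurable_state (k : ℕ) :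
    Measurable[D.past k] (D.x P x₀ k) ∧ Measurable[D.past k] (D.δ P x₀ k) := by
  induction k with
  | zero => exact ⟨measurable_const, measurable_const⟩
  | succ k ih =>
    have h := D.last_le_past_succ k
    have hE := (le_sup_left.trans le_sup_left).trans h
    have hM := (le_sup_right.trans le_sup_left).trans h
    have hQ := le_sup_right.trans h
    have hx := ih.1.mono (D.past_mono (Nat.le_succ k)) le_rfl
    have hδ := ih.2.mono (D.past_mono (Nat.le_succ k)) le_rfl
    have hs := (hrun.meas_s k).mono (D.pastMQ_le_past_succ k) le_rfl
    have hA := measurableSet_accepted (P := P) (x₀ := x₀) (measurable_c_of_le hM)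
      (measurable_g_of_le hM) (measurable_H_of_le hM) hs (measurable_f0_of_le hE)
      (measurable_fs_of_le hE) hδ
    exact ⟨measurable_x_succ hA (measurable_trial (measurable_Q_of_le hQ) hs hx) hx,
      measurable_δ_succ hA hδ⟩

lemma measurable_x (k : ℕ) : Measurable[D.past k] (D.x P x₀ k) := (measurable_state hrun k).1

lemma measurable_δ (k : ℕ) : Measurable[D.past k] (D.δ P x₀ k) := (measurable_state hrun k).2

lemma measurable_φ (hf : ContDiff ℝ 1 f) (k : ℕ) : Measurable[D.past k] (D.φ P f x₀ k) := by
  have h1 : Measurable[D.past k] fun ω => f (D.x P x₀ k ω) :=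
    hf.continuous.measurable.comp (measurable_x hrun k)
  exact ((h1.sub_const P.fmin).const_mul P.ν).add
    (((measurable_δ hrun k).pow_const 2).const_mul (1 - P.ν))

lemma measurable_gradient_x (hf : ContDiff ℝ 1 f) (k : ℕ) :
    Measurable[D.past k] fun ω => gradient f (D.x P x₀ k ω) :=
  (continuous_gradient hf).measurable.comp (measurable_x hrun k)

lemma measurable_pullGrad_pastQ (hf : ContDiff ℝ 1 f) (k : ℕ) :
    Measurable[D.pastQ k] (D.pullGrad P f x₀ k) :=
  measurable_pullGrad hf (measurable_Q_of_le le_sup_right)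
    ((measurable_x hrun k).mono (D.past_le_pastQ k) le_rfl)

lemma measurableSet_modelGood_pastMQ (hf : ContDiff ℝ 1 f) (k : ℕ) :
    MeasurableSet[D.pastMQ k] (D.modelGood P f x₀ k) := by
  have hM : D.sigmaModel k ≤ D.pastMQ k := le_sup_right
  have hQ : D.sigmaQ k ≤ D.pastMQ k := le_trans le_sup_right (D.pastQ_le_pastMQ k)
  have hp : D.past k ≤ D.pastMQ k := (D.past_le_pastQ k).trans (D.pastQ_le_pastMQ k)
  exact measurableSet_modelGood hf (measurable_Q_of_le hQ) (measurable_c_of_le hM)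
    (measurable_g_of_le hM) (measurable_H_of_le hM) (hrun.meas_s k)
    ((measurable_x hrun k).mono hp le_rfl) ((measurable_δ hrun k).mono hp le_rfl)

end Adapted

/-! ### Uniform bounds at each fixed iteration, for integrability. -/

section Bounds

variable {n p : ℕ} {Ω : Type*} {D : Data n p Ω} {P : Params} {f : E n → ℝ} {x₀ : E n}
  {mΩ : MeasurableSpace Ω} {NH : Seminorm ℝ (Matrix (Fin p) (Fin p) ℝ)}
  {NQ : Seminorm ℝ (Matrix (Fin n) (Fin p) ℝ)}
  (hP : P.Admissible) (hrun : D.IsRun P x₀ NH) (hNQ : Consistent NQ)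
  (hQ : ∀ k ω, NQ (D.Q k ω) ≤ P.Qmax)
include hP hrun hNQ hQ

/-- At each fixed `k` the iterate stays in a deterministic ball, so Lipschitz continuity bounds the
merit and the gradient uniformly over realizations. -/
lemma norm_x_sub_le (k : ℕ) (ω : Ω) : ‖D.x P x₀ k ω - x₀‖ ≤ k * (P.Qmax * P.δmax) := by
  have hQm := hP.Qmax_pos
  have hδm : 0 < P.δmax := hP.δ₀_pos.trans_le hP.δ₀_le_δmax
  induction k with
  | zero => simp [x_zero]
  | succ k ih =>
    push_cast
    by_cases h : ω ∈ D.accepted P x₀ k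
    · rw [x_succ_of_accepted h, trial, add_sub_right_comm, add_mul, one_mul]
      refine (norm_add_le _ _).trans (add_le_add ih ?_)
      refine (norm_mulE_s_le hP hrun hNQ (hQ k ω)).trans ?_
      gcongr
      exact δ_le_δmax hP k ω
    · rw [x_succ_of_not_accepted h]
      have : 0 < P.Qmax * P.δmax := by positivity
      linarith

lemma exists_abs_φ_le {Lf : ℝ≥0} (hL : ∀ ω, LipschitzOnWith Lf f (D.region P x₀ ω)) (k : ℕ) :
    ∃ K, ∀ ω, |D.φ P f x₀ k ω| ≤ K := by
  refine ⟨P.ν * (Lf * (k * (P.Qmax * P.δmax)) + |f x₀ - P.fmin|) + (1 - P.ν) * P.δmax ^ 2,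
    fun ω => ?_⟩
  have h1 := (hL ω).dist_le_mul _ (x_mem_region (k := k) hP hrun) _
    (x_mem_region (k := 0) hP hrun)
  rw [x_zero, dist_eq_norm, dist_eq_norm, Real.norm_eq_abs] at h1
  have h2 := norm_x_sub_le hP hrun hNQ hQ k ω
  have h3 : |f (D.x P x₀ k ω) - P.fmin| ≤
      Lf * (k * (P.Qmax * P.δmax)) + |f x₀ - P.fmin| := by
    have e : f (D.x P x₀ k ω) - P.fmin = (f (D.x P x₀ k ω) - f x₀) + (f x₀ - P.fmin) := by ring
    rw [e]
    refine (abs_add_le _ _).trans ?_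
    gcongr
    exact h1.trans (by gcongr)
  have h4 : 0 ≤ 1 - P.ν := by linarith [hP.ν_lt]
  have h5 := δ_pos (D := D) (x₀ := x₀) hP k ω
  have hν := hP.ν_pos
  unfold φ Params.merit
  refine (abs_add_le _ _).trans ?_
  rw [abs_mul, abs_of_pos hν, abs_mul, abs_of_nonneg h4, abs_of_nonneg (sq_nonneg (D.δ P x₀ k ω))]
  gcongr
  exact δ_le_δmax hP k ω

lemma exists_norm_pullGrad_le (hL : ∀ ω, LipschitzOnWith P.Lg (gradient f) (D.region P x₀ ω))
    (k : ℕ) : ∃ K, ∀ ω, ‖D.pullGrad P f x₀ k ω‖ ≤ K := by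
  refine ⟨P.Qmax * (P.Lg * (k * (P.Qmax * P.δmax)) + ‖gradient f x₀‖), fun ω => ?_⟩
  have hQm := hP.Qmax_pos
  refine (norm_mulE_transpose_le hNQ (hQ k ω) _).trans ?_
  have h1 := (hL ω).dist_le_mul _ (x_mem_region (k := k) hP hrun) _
    (x_mem_region (k := 0) hP hrun)
  rw [x_zero, dist_eq_norm, dist_eq_norm] at h1
  have h2 := norm_x_sub_le hP hrun hNQ hQ k ω
  have h3 := norm_le_norm_sub_add (gradient f (D.x P x₀ k ω)) (gradient f x₀)
  gcongr
  refine h3.trans ?_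
  gcongr
  exact h1.trans (by gcongr)

end Bounds

end Data

/-! ### Integrating conditional probability bounds against weights. -/

section Weights

variable {Ω : Type*} {m mΩ : MeasurableSpace Ω} {μ : Measure Ω} [IsProbabilityMeasure μ]
  {A B : Set Ω} {b K : ℝ} {w : Ω → ℝ}

lemma integrable_of_abs_le (hm : m ≤ mΩ) (hw : Measurable[m] w) (hK : ∀ ω, |w ω| ≤ K) :
    Integrable w μ :=
  Integrable.of_bound (hw.mono hm le_rfl).aestronglyMeasurable K
    (Filter.Eventually.of_forall hK)

lemma CondProbGE.integrable_mul (hm : m ≤ mΩ) (h : CondProbGE μ m B b) (hb : 0 < b)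
    (hw : Measurable[m] w) (hK : ∀ ω, |w ω| ≤ K) :
    Integrable (fun ω => w ω * B.indicator (fun _ => (1 : ℝ)) ω) μ :=
  (h.integrable hb).bdd_mul (hw.mono hm le_rfl).aestronglyMeasurable
    (Filter.Eventually.of_forall hK)

lemma CondProbGE.mul_setIntegral_le (hm : m ≤ mΩ) (h : CondProbGE μ m B b) (hb : 0 < b)
    (hA : MeasurableSet[m] A) (hw : Measurable[m] w) (hw0 : ∀ ω ∈ A, 0 ≤ w ω)
    (hK : ∀ ω, |w ω| ≤ K) :
    b * ∫ ω in A, w ω ∂μ ≤ ∫ ω in A, w ω * B.indicator (fun _ => (1 : ℝ)) ω ∂μ := by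
  rw [← integral_indicator (hm _ hA), ← integral_indicator (hm _ hA)]
  refine (h.mul_integral_le hm hb (hw.indicator hA) (K := K)
    (fun ω => Set.indicator_nonneg hw0 ω) (fun ω => ?_)).trans_eq ?_
  · by_cases hω : ω ∈ A
    · simpa [hω] using (le_abs_self _).trans (hK ω)
    · simpa [hω] using (abs_nonneg _).trans (hK ω)
  · congr 1
    funext ω
    by_cases hω : ω ∈ A <;> simp [hω]

end Weights

lemma Params.Admissible.ϱ_le {P : Params} (hP : P.Admissible) : P.ϱ ≤ 1 - P.ν := by
  have h1 : 0 < 1 - P.ν := by linarith [hP.ν_lt]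
  have h2 : (1 - P.ν) * (1 - 1 / P.γ ^ 2) ≤ (1 - P.ν) * 1 := by
    gcongr
    have : 0 ≤ 1 / P.γ ^ 2 := by positivity
    linarith
  have h3 := mul_le_mul_of_nonneg_left h2 hP.βf_pos.le
  have h4 := mul_le_mul_of_nonneg_right hP.βf_lt.le h1.le
  unfold Params.ϱ
  linarith

namespace Data

variable {n p : ℕ} {Ω : Type*} {D : Data n p Ω} {P : Params} {f : E n → ℝ} {x₀ : E n}
  {mΩ : MeasurableSpace Ω} {μ : Measure Ω} [IsProbabilityMeasure μ]
  {NH : Seminorm ℝ (Matrix (Fin p) (Fin p) ℝ)} {NQ : Seminorm ℝ (Matrix (Fin n) (Fin p) ℝ)}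

lemma condProbGE_modelGood (hP : P.Admissible) (hrun : D.IsRun P x₀ NH) (hf : ContDiff ℝ 1 f)
    (hmodel : D.ProbFullyLinear P f x₀ μ P.κef P.κeg P.βm) (k : ℕ) :
    CondProbGE μ (D.pastQ k) (D.modelGood P f x₀ k) P.βm :=
  (hmodel k).mono hP.βm_pos (fun _ h => modelGood_of_fullyLinear hP hrun h)
    (pastMQ_le hrun k _ (measurableSet_modelGood_pastMQ hrun hf k))

/-- The bound for the estimates is conditional on `pastMQ`. The probabilities multiply because
`modelGood`, unlike full linearity as stated, is shown to belong to that σ-algebra. -/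
lemma condProbGE_modelGood_inter_estGood (hP : P.Admissible) (hrun : D.IsRun P x₀ NH)
    (hf : ContDiff ℝ 1 f) (hmodel : D.ProbFullyLinear P f x₀ μ P.κef P.κeg P.βm)
    (hest : D.ProbAccurate P f x₀ μ P.εf P.βf) (k : ℕ) :
    CondProbGE μ (D.pastQ k) (D.modelGood P f x₀ k ∩ D.estGood P f x₀ k) (P.βm * P.βf) :=
  (condProbGE_modelGood hP hrun hf hmodel k).inter (D.pastQ_le_pastMQ k) (pastMQ_le hrun k)
    (hest k) hP.βf_pos (measurableSet_modelGood_pastMQ hrun hf k)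

lemma condProbGE_estGood (hP : P.Admissible) (hrun : D.IsRun P x₀ NH)
    (hest : D.ProbAccurate P f x₀ μ P.εf P.βf) (k : ℕ) :
    CondProbGE μ (D.pastQ k) (D.estGood P f x₀ k) P.βf :=
  CondProbGE.of_le (D.pastQ_le_pastMQ k) (pastMQ_le hrun k) (hest k) hP.βf_pos

/-- The bound on the increase of the merit function in an arbitrary iteration. -/
def maxIncrease (D : Data n p Ω) (P : Params) (f : E n → ℝ) (x₀ : E n) (k : ℕ) (ω : Ω) : ℝ :=
  P.ν * P.C₃ * max ‖D.pullGrad P f x₀ k ω‖ (P.ζ * D.δ P x₀ k ω) * D.δ P x₀ k ω +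
    (1 - P.ν) * (P.γ ^ 2 - 1) * D.δ P x₀ k ω ^ 2

/-- The bound on the decrease of the merit function in an iteration with accurate model and
estimates and a large pulled back gradient. -/
def goodDecrease (D : Data n p Ω) (P : Params) (f : E n → ℝ) (x₀ : E n) (k : ℕ) (ω : Ω) : ℝ :=
  P.ν * P.C₁ * ‖D.pullGrad P f x₀ k ω‖ * D.δ P x₀ k ω -
    (1 - P.ν) * (P.γ ^ 2 - 1) * D.δ P x₀ k ω ^ 2

section

variable (hP : P.Admissible) (hrun : D.IsRun P x₀ NH) (hNQ : Consistent NQ)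
  (hQ : ∀ k ω, NQ (D.Q k ω) ≤ P.Qmax) (hf : ContDiff ℝ 1 f)
  (hgL : ∀ ω, LipschitzOnWith P.Lg (gradient f) (D.region P x₀ ω))

include hP in
lemma maxIncrease_nonneg (k : ℕ) (ω : Ω) : 0 ≤ D.maxIncrease P f x₀ k ω := by
  have hδ := δ_pos (D := D) (x₀ := x₀) hP k ω
  have hγ : 0 ≤ P.γ ^ 2 - 1 := by linarith [one_lt_pow₀ hP.γ_gt (n := 2) (by norm_num)]
  have hν : 0 ≤ 1 - P.ν := by linarith [hP.ν_lt]
  have hν' := hP.ν_pos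
  have hC : 0 ≤ P.C₃ := zero_le_one.trans hP.one_le_C₃
  have hζ := hP.ζ_pos
  unfold maxIncrease
  positivity

include hrun hf in
lemma measurable_maxIncrease (k : ℕ) : Measurable[D.pastQ k] (D.maxIncrease P f x₀ k) := by
  have h1 := (measurable_δ (P := P) hrun k).mono (D.past_le_pastQ k) le_rfl
  have h2 := measurable_pullGrad_pastQ (P := P) hrun hf k
  exact ((((measurable_norm.comp h2).max (h1.const_mul _)).const_mul _).mul h1).add
    ((h1.pow_const 2).const_mul _)

include hrun hf in
lemma measurable_goodDecrease (k : ℕ) : Measurable[D.pastQ k] (D.goodDecrease P f x₀ k) := by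
  have h1 := (measurable_δ (P := P) hrun k).mono (D.past_le_pastQ k) le_rfl
  have h2 := measurable_pullGrad_pastQ (P := P) hrun hf k
  exact (((measurable_norm.comp h2).const_mul _).mul h1).sub ((h1.pow_const 2).const_mul _)

include hP hrun hNQ hQ hgL

lemma exists_abs_maxIncrease_le (k : ℕ) : ∃ K, ∀ ω, |D.maxIncrease P f x₀ k ω| ≤ K := by
  obtain ⟨K, hK⟩ := exists_norm_pullGrad_le hP hrun hNQ hQ hgL k
  have hγ : 0 ≤ P.γ ^ 2 - 1 := by linarith [one_lt_pow₀ hP.γ_gt (n := 2) (by norm_num)]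
  have hν : 0 ≤ 1 - P.ν := by linarith [hP.ν_lt]
  have hν' := hP.ν_pos
  have hC : 0 ≤ P.C₃ := zero_le_one.trans hP.one_le_C₃
  have hζ := hP.ζ_pos
  refine ⟨P.ν * P.C₃ * max K (P.ζ * P.δmax) * P.δmax +
    (1 - P.ν) * (P.γ ^ 2 - 1) * P.δmax ^ 2, fun ω => ?_⟩
  have hδ := δ_pos (D := D) (x₀ := x₀) hP k ω
  have hδm := δ_le_δmax (D := D) (x₀ := x₀) hP k ω
  rw [abs_of_nonneg (maxIncrease_nonneg hP k ω)]
  have h1 : 0 ≤ max K (P.ζ * P.δmax) :=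
    le_max_of_le_left ((norm_nonneg _).trans (hK ω))
  unfold maxIncrease
  gcongr
  exact hK ω

lemma exists_abs_goodDecrease_le (k : ℕ) : ∃ K, ∀ ω, |D.goodDecrease P f x₀ k ω| ≤ K := by
  obtain ⟨K, hK⟩ := exists_norm_pullGrad_le hP hrun hNQ hQ hgL k
  have hγ : 0 ≤ P.γ ^ 2 - 1 := by linarith [one_lt_pow₀ hP.γ_gt (n := 2) (by norm_num)]
  have hν : 0 ≤ 1 - P.ν := by linarith [hP.ν_lt]
  have hν' := hP.ν_pos
  have hC := hP.C₁_pos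
  refine ⟨P.ν * P.C₁ * K * P.δmax + (1 - P.ν) * (P.γ ^ 2 - 1) * P.δmax ^ 2, fun ω => ?_⟩
  have hδ := δ_pos (D := D) (x₀ := x₀) hP k ω
  have hδm := δ_le_δmax (D := D) (x₀ := x₀) hP k ω
  have h1 : 0 ≤ K := (norm_nonneg _).trans (hK ω)
  unfold goodDecrease
  refine (abs_sub _ _).trans ?_
  rw [abs_of_nonneg (by positivity), abs_of_nonneg (by positivity)]
  gcongr
  exact hK ω

end

/-! ### Expected decrease of the merit function. -/

section Drift

variable (hP : P.Admissible) (hrun : D.IsRun P x₀ NH) (hNQ : Consistent NQ)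
  (hQ : ∀ k ω, NQ (D.Q k ω) ≤ P.Qmax) (hf : ContDiff ℝ 1 f)
  (hgL : ∀ ω, LipschitzOnWith P.Lg (gradient f) (D.region P x₀ ω))
  {Lf : ℝ≥0} (hfL : ∀ ω, LipschitzOnWith Lf f (D.region P x₀ ω))
  (hH : ∀ k ω, NH (D.H k ω) ≤ P.κh)
  (hest : D.ProbAccurate P f x₀ μ P.εf P.βf)

include hP hrun in
lemma integrable_δ_sq (k : ℕ) : Integrable (fun ω => D.δ P x₀ k ω ^ 2) μ := by
  refine integrable_of_abs_le (past_le hrun k) ((measurable_δ hrun k).pow_const 2)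
    (K := P.δmax ^ 2) fun ω => ?_
  rw [abs_of_nonneg (sq_nonneg _)]
  exact pow_le_pow_left₀ (δ_pos hP k ω).le (δ_le_δmax hP k ω) 2

include hP hrun hNQ hQ hf hfL in
lemma integrable_φ (k : ℕ) : Integrable (D.φ P f x₀ k) μ := by
  obtain ⟨K, hK⟩ := exists_abs_φ_le hP hrun hNQ hQ hfL k
  exact integrable_of_abs_le (past_le hrun k) (measurable_φ hrun hf k) hK

include hP hrun hNQ hQ hf hgL hfL hH hest

/-- Expected decrease of the merit function where the pulled back gradient is small. -/
lemma setIntegral_merit_change_le_of_pullGrad_lt {k : ℕ} {A : Set Ω}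
    (hA : MeasurableSet[D.pastQ k] A)
    (hAζ : ∀ ω ∈ A, ‖D.pullGrad P f x₀ k ω‖ ≤ P.ζ * D.δ P x₀ k ω) :
    ∫ ω in A, (D.φ P f x₀ (k + 1) ω - D.φ P f x₀ k ω) ∂μ ≤
      ∫ ω in A, -(P.ϱ * D.δ P x₀ k ω ^ 2) ∂μ := by
  have hm := pastQ_le hrun k
  have hJ := condProbGE_estGood hP hrun hest k
  set w := D.maxIncrease P f x₀ k with hw
  set d : Ω → ℝ := fun ω => (1 - P.ν) * (1 - 1 / P.γ ^ 2) * D.δ P x₀ k ω ^ 2 with hd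
  set J := (D.estGood P f x₀ k).indicator fun _ => (1 : ℝ) with hJdef
  obtain ⟨K, hK⟩ := exists_abs_maxIncrease_le hP hrun hNQ hQ hgL k
  have hwm := measurable_maxIncrease (P := P) hrun hf k
  have hdm : Measurable[D.pastQ k] d :=
    (((measurable_δ hrun k).mono (D.past_le_pastQ k) le_rfl).pow_const 2).const_mul _
  have hd0 : ∀ ω, 0 ≤ d ω := fun ω => mul_nonneg hP.shrink_pos.le (sq_nonneg _)
  have hdK : ∀ ω, |d ω| ≤ (1 - P.ν) * (1 - 1 / P.γ ^ 2) * P.δmax ^ 2 := fun ω => by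
    rw [abs_of_nonneg (hd0 ω)]
    exact mul_le_mul_of_nonneg_left
      (pow_le_pow_left₀ (δ_pos hP k ω).le (δ_le_δmax hP k ω) 2) hP.shrink_pos.le
  have iw : Integrable w μ := integrable_of_abs_le hm hwm hK
  have id' : Integrable d μ := integrable_of_abs_le hm hdm hdK
  have iwJ : Integrable (fun ω => w ω * J ω) μ := hJ.integrable_mul hm hP.βf_pos hwm hK
  have idJ : Integrable (fun ω => d ω * J ω) μ := hJ.integrable_mul hm hP.βf_pos hdm hdK
  have iwwJ : Integrable (fun ω => w ω - w ω * J ω) μ := iw.sub iwJ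
  have iwβ : Integrable (fun ω => w ω - P.βf * w ω) μ := iw.sub (iw.const_mul _)
  have hAm := hm _ hA
  have e1 := hJ.mul_setIntegral_le hm hP.βf_pos hA hwm
    (fun ω _ => maxIncrease_nonneg hP k ω) hK
  have e2 := hJ.mul_setIntegral_le hm hP.βf_pos hA hdm (fun ω _ => hd0 ω) hdK
  calc ∫ ω in A, (D.φ P f x₀ (k + 1) ω - D.φ P f x₀ k ω) ∂μ
      ≤ ∫ ω in A, (w ω - w ω * J ω - d ω * J ω) ∂μ := by
        refine integral_mono_ae ((integrable_φ hP hrun hNQ hQ hf hfL (k + 1)).sub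
          (integrable_φ hP hrun hNQ hQ hf hfL k)).integrableOn
          (iwwJ.sub idJ).integrableOn (Filter.Eventually.of_forall fun ω => ?_)
        by_cases hω : ω ∈ D.estGood P f x₀ k
        · have := merit_change_of_estGood hP hrun (hH k ω) hω
          simp only [hJdef, Set.indicator_of_mem hω, hd]
          linarith
        · have := merit_change_le hP hrun hf (hgL ω) hNQ (hQ k ω) (k := k)
          simp only [hJdef, Set.indicator_of_notMem hω, mul_zero, sub_zero]
          exact this
    _ = ∫ ω in A, w ω ∂μ - ∫ ω in A, w ω * J ω ∂μ - ∫ ω in A, d ω * J ω ∂μ := by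
        rw [integral_sub iwwJ.integrableOn idJ.integrableOn,
          integral_sub iw.integrableOn iwJ.integrableOn]
    -- Both `w` and `d` are nonnegative and `pastQ`-measurable, so inside the integrals the
    -- indicator `J` can be replaced by its lower bound `βf`.
    _ ≤ ∫ ω in A, w ω ∂μ - P.βf * ∫ ω in A, w ω ∂μ - P.βf * ∫ ω in A, d ω ∂μ := by
        linarith
    _ = ∫ ω in A, (w ω - P.βf * w ω - P.βf * d ω) ∂μ := by
        rw [integral_sub iwβ.integrableOn (id'.const_mul _).integrableOn,
          integral_sub iw.integrableOn (iw.const_mul _).integrableOn, integral_const_mul P.βf w,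
          integral_const_mul P.βf d]
    _ ≤ ∫ ω in A, -(P.ϱ * D.δ P x₀ k ω ^ 2) ∂μ := by
        refine setIntegral_mono_on (iwβ.sub (id'.const_mul _)).integrableOn
          ((integrable_δ_sq hP hrun k).const_mul _).neg.integrableOn hAm fun ω hω => ?_
        have h1 := mul_le_mul_of_nonneg_right hP.βf_weight (sq_nonneg (D.δ P x₀ k ω))
        simp only [hw, hd, maxIncrease, max_eq_right (hAζ ω hω), Params.ϱ]
        linarith

/-- Expected decrease of the merit function where the pulled back gradient is large. -/
lemma setIntegral_merit_change_le_of_le_pullGrad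
    (hmodel : D.ProbFullyLinear P f x₀ μ P.κef P.κeg P.βm) {k : ℕ} {A : Set Ω}
    (hA : MeasurableSet[D.pastQ k] A)
    (hAζ : ∀ ω ∈ A, P.ζ * D.δ P x₀ k ω ≤ ‖D.pullGrad P f x₀ k ω‖) :
    ∫ ω in A, (D.φ P f x₀ (k + 1) ω - D.φ P f x₀ k ω) ∂μ ≤
      ∫ ω in A, -(P.ϱ * D.δ P x₀ k ω ^ 2) ∂μ := by
  have hm := pastQ_le hrun k
  have hβ : 0 < P.βm * P.βf := mul_pos hP.βm_pos hP.βf_pos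
  have hI := condProbGE_modelGood hP hrun hf hmodel k
  have hIJ := condProbGE_modelGood_inter_estGood hP hrun hf hmodel hest k
  set w := D.maxIncrease P f x₀ k with hw
  set u := D.goodDecrease P f x₀ k with hu
  set I := (D.modelGood P f x₀ k).indicator fun _ => (1 : ℝ) with hIdef
  set T := (D.modelGood P f x₀ k ∩ D.estGood P f x₀ k).indicator fun _ => (1 : ℝ) with hTdef
  obtain ⟨K, hK⟩ := exists_abs_maxIncrease_le hP hrun hNQ hQ hgL k
  obtain ⟨K', hK'⟩ := exists_abs_goodDecrease_le hP hrun hNQ hQ hgL k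
  have hwm := measurable_maxIncrease (P := P) hrun hf k
  have hum := measurable_goodDecrease (P := P) hrun hf k
  have hν : 0 ≤ 1 - P.ν := by linarith [hP.ν_lt]
  have hu7 : ∀ ω ∈ A, 7 * P.γ ^ 2 * (1 - P.ν) * D.δ P x₀ k ω ^ 2 ≤ u ω := fun ω hω =>
    gain_nonneg hP (hAζ ω hω)
  have hu0 : ∀ ω ∈ A, 0 ≤ u ω := fun ω hω => le_trans (by positivity) (hu7 ω hω)
  have iw : Integrable w μ := integrable_of_abs_le hm hwm hK
  have iu : Integrable u μ := integrable_of_abs_le hm hum hK'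
  have iwI : Integrable (fun ω => w ω * I ω) μ := hI.integrable_mul hm hP.βm_pos hwm hK
  have iuT : Integrable (fun ω => u ω * T ω) μ := hIJ.integrable_mul hm hβ hum hK'
  have iwwI : Integrable (fun ω => w ω - w ω * I ω) μ := iw.sub iwI
  have iwβ : Integrable (fun ω => w ω - P.βm * w ω) μ := iw.sub (iw.const_mul _)
  have hAm := hm _ hA
  have e1 := hI.mul_setIntegral_le hm hP.βm_pos hA hwm
    (fun ω _ => maxIncrease_nonneg hP k ω) hK
  have e2 := hIJ.mul_setIntegral_le hm hβ hA hum hu0 hK'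
  calc ∫ ω in A, (D.φ P f x₀ (k + 1) ω - D.φ P f x₀ k ω) ∂μ
      ≤ ∫ ω in A, (w ω - w ω * I ω - u ω * T ω) ∂μ := by
        refine setIntegral_mono_on ((integrable_φ hP hrun hNQ hQ hf hfL (k + 1)).sub
          (integrable_φ hP hrun hNQ hQ hf hfL k)).integrableOn
          (iwwI.sub iuT).integrableOn hAm fun ω hωA => ?_
        -- With both accurate, the decrease is at least `u`; with only the model accurate, there is
        -- no increase; with an inaccurate model, the increase is at most `w`.
        by_cases hωI : ω ∈ D.modelGood P f x₀ k
        · by_cases hωJ : ω ∈ D.estGood P f x₀ k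
          · have hωT : ω ∈ D.modelGood P f x₀ k ∩ D.estGood P f x₀ k := ⟨hωI, hωJ⟩
            have hacc : ω ∈ D.accepted P x₀ k := by
              refine mem_accepted hP hrun (hH k ω) hωI hωJ (le_trans ?_ (hAζ ω hωA))
              exact mul_le_mul_of_nonneg_right hP.ζ_ge (δ_pos hP k ω).le
            have := merit_change_of_modelGood hP hrun (hH k ω) hωI (hAζ ω hωA) hacc
            simp only [hIdef, hTdef, Set.indicator_of_mem hωI, Set.indicator_of_mem hωT, hu,
              goodDecrease]
            linarith
          · have hωT : ω ∉ D.modelGood P f x₀ k ∩ D.estGood P f x₀ k := fun h => hωJ h.2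
            have := merit_change_nonpos_of_modelGood hP hrun (hH k ω) hωI (hAζ ω hωA)
            simp only [hIdef, hTdef, Set.indicator_of_mem hωI, Set.indicator_of_notMem hωT]
            linarith
        · have hωT : ω ∉ D.modelGood P f x₀ k ∩ D.estGood P f x₀ k := fun h => hωI h.1
          have := merit_change_le hP hrun hf (hgL ω) hNQ (hQ k ω) (k := k)
          simp only [hIdef, hTdef, Set.indicator_of_notMem hωI, Set.indicator_of_notMem hωT,
            mul_zero, sub_zero]
          exact this
    _ = ∫ ω in A, w ω ∂μ - ∫ ω in A, w ω * I ω ∂μ - ∫ ω in A, u ω * T ω ∂μ := by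
        rw [integral_sub iwwI.integrableOn iuT.integrableOn,
          integral_sub iw.integrableOn iwI.integrableOn]
    _ ≤ ∫ ω in A, w ω ∂μ - P.βm * ∫ ω in A, w ω ∂μ - P.βm * P.βf * ∫ ω in A, u ω ∂μ := by
        linarith
    _ = ∫ ω in A, (w ω - P.βm * w ω - P.βm * P.βf * u ω) ∂μ := by
        rw [integral_sub iwβ.integrableOn (iu.const_mul _).integrableOn,
          integral_sub iw.integrableOn (iw.const_mul _).integrableOn, integral_const_mul,
          integral_const_mul]
    _ ≤ ∫ ω in A, -(P.ϱ * D.δ P x₀ k ω ^ 2) ∂μ := by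
        refine setIntegral_mono_on (iwβ.sub (iu.const_mul _)).integrableOn
          ((integrable_δ_sq hP hrun k).const_mul _).neg.integrableOn hAm fun ω hω => ?_
        have hδ := δ_pos (D := D) (x₀ := x₀) hP k ω
        have h7 := hu7 ω hω
        have hνG : 0 ≤ P.ν * (‖D.pullGrad P f x₀ k ω‖ * D.δ P x₀ k ω) :=
          mul_nonneg hP.ν_pos.le (by positivity)
        -- This turns `(1 - βm) w - βm βf u` into at most `-u / 2` plus half of `γ ^ 2 (1 - ν) δ ^
        -- 2`. As `u` is at least seven times `γ ^ 2 (1 - ν) δ ^ 2`, three times that amount is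
        -- left, which exceeds `ϱ δ ^ 2`.
        have hC₃ : P.C₃ * (1 - P.βm) ≤ P.C₁ * (P.βm * P.βf - 1 / 2) := by
          have h1 := hP.C₃_mul_le
          have h2 : 0 ≤ P.C₃ * (1 - P.βf) :=
            mul_nonneg (zero_le_one.trans hP.one_le_C₃) (by linarith [hP.βf_lt])
          linarith
        have h1 := mul_le_mul_of_nonneg_right hC₃ hνG
        have h2 : (1 - P.βm + P.βm * P.βf - 1 / 2) *
            ((1 - P.ν) * (P.γ ^ 2 - 1) * D.δ P x₀ k ω ^ 2) ≤
            1 / 2 * ((1 - P.ν) * P.γ ^ 2 * D.δ P x₀ k ω ^ 2) := by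
          have hγ : 0 ≤ P.γ ^ 2 - 1 := by linarith [one_lt_pow₀ hP.γ_gt (n := 2) (by norm_num)]
          have h3 : P.βm * P.βf ≤ P.βm := mul_le_of_le_one_right hP.βm_pos.le hP.βf_lt.le
          refine mul_le_mul (by linarith) ?_ (by positivity) (by norm_num)
          gcongr
          linarith
        have h3 : P.ϱ * D.δ P x₀ k ω ^ 2 ≤ P.γ ^ 2 * (1 - P.ν) * D.δ P x₀ k ω ^ 2 := by
          gcongr
          refine hP.ϱ_le.trans (le_mul_of_one_le_left hν (one_le_pow₀ hP.γ_gt.le))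
        have h4 : 0 ≤ P.γ ^ 2 * (1 - P.ν) * D.δ P x₀ k ω ^ 2 := by positivity
        simp only [hw, hu, maxIncrease, goodDecrease, max_eq_left (hAζ ω hω)] at h7 ⊢
        linarith

/-- Expected decrease of the merit function in one iteration. -/
lemma setIntegral_merit_change_le (hmodel : D.ProbFullyLinear P f x₀ μ P.κef P.κeg P.βm)
    {k : ℕ} {A : Set Ω} (hA : MeasurableSet[D.past k] A) :
    ∫ ω in A, (D.φ P f x₀ (k + 1) ω - D.φ P f x₀ k ω) ∂μ ≤
      ∫ ω in A, -(P.ϱ * D.δ P x₀ k ω ^ 2) ∂μ := by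
  have hm := pastQ_le hrun k
  have hA' := D.past_le_pastQ k _ hA
  -- The splitting event involves `Q k`, so it lies in `pastQ` and need not lie in `past`; hence
  -- both cases are stated for `pastQ` events.
  have hS : MeasurableSet[D.pastQ k]
      {ω | P.ζ * D.δ P x₀ k ω ≤ ‖D.pullGrad P f x₀ k ω‖} := by
    have h1 := ((measurable_δ hrun k).mono (D.past_le_pastQ k) le_rfl).const_mul P.ζ
    have h2 := measurable_norm.comp (measurable_pullGrad_pastQ (P := P) hrun hf k)
    exact @measurableSet_le _ _ _ _ _ (D.pastQ k) _ _ _ _ _ h1 h2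
  have i1 : Integrable (fun ω => D.φ P f x₀ (k + 1) ω - D.φ P f x₀ k ω) μ :=
    (integrable_φ hP hrun hNQ hQ hf hfL (k + 1)).sub (integrable_φ hP hrun hNQ hQ hf hfL k)
  have i2 : Integrable (fun ω => -(P.ϱ * D.δ P x₀ k ω ^ 2)) μ :=
    ((integrable_δ_sq hP hrun k).const_mul P.ϱ).neg
  rw [← integral_inter_add_sdiff (hm _ hS) i1.integrableOn,
    ← integral_inter_add_sdiff (hm _ hS) i2.integrableOn]
  refine add_le_add ?_ ?_
  · exact setIntegral_merit_change_le_of_le_pullGrad hP hrun hNQ hQ hf hgL hfL hH hest hmodel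
      (hA'.inter hS) fun ω hω => hω.2
  · exact setIntegral_merit_change_le_of_pullGrad_lt hP hrun hNQ hQ hf hgL hfL hH hest
      (hA'.diff hS) fun ω hω => (not_le.1 hω.2).le

end Drift

end Data

/-! ### Expected hitting times from drift. -/

/-- A nonnegative process that decreases by at least one in expectation on each of a decreasing
sequence of events bounds the sum of their probabilities. -/
lemma tsum_measure_le_of_drift {Ω : Type*} {mΩ : MeasurableSpace Ω} {μ : Measure Ω}
    [IsFiniteMeasure μ] {A : ℕ → Set Ω} (hA : Antitone A) (hAm : ∀ k, MeasurableSet (A k))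
    {V : ℕ → Ω → ℝ} (hV : ∀ k, Integrable (V k) μ) (hV0 : ∀ k ω, 0 ≤ V k ω)
    (hd : ∀ k, ∫ ω in A k, (V (k + 1) ω - V k ω) ∂μ ≤ -μ.real (A k)) :
    ∑' k, μ (A k) ≤ ENNReal.ofReal (∫ ω, V 0 ω ∂μ) := by
  have key : ∀ N, ∑ k ∈ Finset.range N, μ.real (A k) + ∫ ω in A N, V N ω ∂μ ≤
      ∫ ω, V 0 ω ∂μ := by
    intro N
    induction N with
    | zero =>
      simpa using setIntegral_le_integral (hV 0) (Filter.Eventually.of_forall (hV0 0))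
    | succ N ih =>
      have h1 := hd N
      rw [integral_sub (hV _).integrableOn (hV _).integrableOn] at h1
      -- Nonnegativity of `V` allows the integral to be restricted to the smaller next event, which
      -- makes the sum telescope.
      have h2 : ∫ ω in A (N + 1), V (N + 1) ω ∂μ ≤ ∫ ω in A N, V (N + 1) ω ∂μ :=
        setIntegral_mono_set (hV _).integrableOn
          (Filter.Eventually.of_forall (hV0 _)) (hA (Nat.le_succ N)).eventuallyLE
      rw [Finset.sum_range_succ]
      linarith
  rw [ENNReal.tsum_eq_iSup_nat]
  refine iSup_le fun N => ?_
  have h1 : ∑ k ∈ Finset.range N, μ (A k) =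
      ENNReal.ofReal (∑ k ∈ Finset.range N, μ.real (A k)) := by
    rw [ENNReal.ofReal_sum_of_nonneg fun _ _ => measureReal_nonneg]
    exact Finset.sum_congr rfl fun k _ => (ofReal_measureReal (measure_ne_top _ _)).symm
  rw [h1]
  refine ENNReal.ofReal_le_ofReal (le_trans ?_ (key N))
  have := setIntegral_nonneg (μ := μ) (hAm N) fun ω _ => hV0 N ω
  linarith

/-- The expectation of an extended natural number as the sum of its tail probabilities. -/
lemma lintegral_toENNReal_le_tsum {Ω : Type*} {mΩ : MeasurableSpace Ω} {μ : Measure Ω}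
    {T : Ω → ℕ∞} {A : ℕ → Set Ω} (hAm : ∀ k, MeasurableSet (A k))
    (hT : ∀ (k : ℕ) ω, (k : ℕ∞) < T ω → ω ∈ A k) :
    ∫⁻ ω, (T ω : ℝ≥0∞) ∂μ ≤ ∑' k, μ (A k) := by
  -- Pointwise, `T` is at most the number of events `A k` that occur, also when it is infinite.
  have h1 : ∀ ω, (T ω : ℝ≥0∞) ≤ ∑' k, (A k).indicator (fun _ => (1 : ℝ≥0∞)) ω := by
    intro ω
    have h2 : ∀ N : ℕ, (N : ℕ∞) ≤ T ω →
        (N : ℝ≥0∞) ≤ ∑' k, (A k).indicator (fun _ => (1 : ℝ≥0∞)) ω := by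
      intro N hN
      refine le_trans (le_of_eq ?_) (ENNReal.sum_le_tsum (Finset.range N))
      rw [Finset.sum_congr rfl (g := fun _ => (1 : ℝ≥0∞)) fun k hk => ?_]
      · simp
      · refine Set.indicator_of_mem (hT k ω (lt_of_lt_of_le ?_ hN)) _
        exact_mod_cast Finset.mem_range.1 hk
    induction hTω : T ω using ENat.recTopCoe with
    | top =>
      refine le_of_eq ?_
      rw [eq_comm, ENat.toENNReal_top]
      exact ENNReal.eq_top_of_forall_nnreal_le fun r => by
        obtain ⟨N, hN⟩ := exists_nat_ge r
        refine le_trans ?_ (h2 N (by rw [hTω]; exact le_top))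
        exact_mod_cast hN
    | coe N =>
      rw [ENat.toENNReal_coe]
      exact h2 N hTω.ge
  refine (lintegral_mono h1).trans (le_of_eq ?_)
  rw [lintegral_tsum fun k => (measurable_const.indicator (hAm k)).aemeasurable]
  exact tsum_congr fun k => lintegral_indicator_one (hAm k)

/-! ### Upward drift of small radii, and the combined potential. -/

namespace Data

variable {n p : ℕ} {Ω : Type*} {D : Data n p Ω} {P : Params} {f : E n → ℝ} {x₀ : E n}
  {mΩ : MeasurableSpace Ω} {μ : Measure Ω} [IsProbabilityMeasure μ]
  {NH : Seminorm ℝ (Matrix (Fin p) (Fin p) ℝ)} {NQ : Seminorm ℝ (Matrix (Fin n) (Fin p) ℝ)}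

/-- The logarithm to base `γ` of the radius relative to `d`, cut off at zero. -/
def logGap (D : Data n p Ω) (P : Params) (x₀ : E n) (d : ℝ) (k : ℕ) (ω : Ω) : ℝ :=
  min (Real.logb P.γ (D.δ P x₀ k ω / d)) 0

/-- The realizations for which `Q_k` is well aligned with the gradient at the current iterate. -/
def aligned (D : Data n p Ω) (P : Params) (f : E n → ℝ) (x₀ : E n) (k : ℕ) : Set Ω :=
  {ω | P.αQ * ‖gradient f (D.x P x₀ k ω)‖ ≤ ‖D.pullGrad P f x₀ k ω‖}

/-- The event that the gradient norm exceeds `ε` at the iterates `0, …, k`. -/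
def notYet (D : Data n p Ω) (P : Params) (f : E n → ℝ) (x₀ : E n) (ε : ℝ) (k : ℕ) : Set Ω :=
  ⋂ j ∈ Set.Iic k, {ω | ε < ‖gradient f (D.x P x₀ j ω)‖}

lemma mem_notYet_of_lt_τ {ε : ℝ} {k : ℕ} {ω : Ω} (h : (k : ℕ∞) < D.τ P f x₀ ε ω) :
    ω ∈ D.notYet P f x₀ ε k := by
  refine Set.mem_iInter₂.2 fun j hj => ?_
  by_contra hn
  have h1 : D.τ P f x₀ ε ω ≤ j := iInf₂_le_of_le j (not_lt.1 hn) le_rfl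
  exact absurd (h.trans_le h1) (not_lt.2 (by exact_mod_cast hj))

lemma antitone_notYet (ε : ℝ) : Antitone (D.notYet P f x₀ ε) := fun _ _ h =>
  Set.biInter_subset_biInter_left (Set.Iic_subset_Iic.2 h)

lemma measurableSet_notYet (hrun : D.IsRun P x₀ NH) (hf : ContDiff ℝ 1 f) (ε : ℝ) (k : ℕ) :
    MeasurableSet[D.past k] (D.notYet P f x₀ ε k) := by
  refine MeasurableSet.biInter (Set.to_countable _) fun j hj => ?_
  have h := measurable_norm.comp (measurable_gradient_x (P := P) (x₀ := x₀) hrun hf j)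
  exact D.past_mono hj _ (h measurableSet_Ioi)

section LogGap

variable {d : ℝ} {k : ℕ} {ω : Ω} (hP : P.Admissible) (hd : 0 < d)

lemma logGap_nonpos : D.logGap P x₀ d k ω ≤ 0 := min_le_right _ _

include hP in
lemma logGap_zero (hd : 0 < d) (hdδ : d ≤ P.δ₀) : D.logGap P x₀ d 0 ω = 0 := by
  refine min_eq_right (Real.logb_nonneg hP.γ_gt ?_)
  rw [δ_zero, le_div_iff₀ hd]
  linarith

include hP hd

lemma logGap_sub_one_le : D.logGap P x₀ d k ω - 1 ≤ D.logGap P x₀ d (k + 1) ω := by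
  have hδ := δ_pos (D := D) (x₀ := x₀) hP k ω
  have hγ := hP.γ_pos
  have h0 : D.logGap P x₀ d k ω ≤ 0 := logGap_nonpos
  refine le_min ?_ (by linarith)
  have h1 : Real.logb P.γ (P.γ⁻¹ * (D.δ P x₀ k ω / d)) = -1 + Real.logb P.γ (D.δ P x₀ k ω / d) := by
    rw [Real.logb_mul (by positivity) (by positivity), Real.logb_inv,
      Real.logb_self_eq_one hP.γ_gt]
  have h2 : P.γ⁻¹ * (D.δ P x₀ k ω / d) ≤ D.δ P x₀ (k + 1) ω / d := by
    rw [← mul_div_assoc]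
    gcongr
    exact inv_mul_δ_le_δ_succ hP k ω
  have h3 := Real.logb_le_logb_of_le hP.γ_gt (by positivity) h2
  have h4 : D.logGap P x₀ d k ω ≤ Real.logb P.γ (D.δ P x₀ k ω / d) := min_le_left _ _
  linarith

/-- Under `γ δ ≤ d` neither the cap `δmax` nor the cut-off at zero truncates the step, so no grid of
radii aligned with `d` is needed. -/
lemma logGap_add_one_le_of_accepted (hdδ : d ≤ P.δ₀) (h : ω ∈ D.accepted P x₀ k)
    (hk : P.γ * D.δ P x₀ k ω ≤ d) : D.logGap P x₀ d k ω + 1 ≤ D.logGap P x₀ d (k + 1) ω := by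
  have hδ := δ_pos (D := D) (x₀ := x₀) hP k ω
  have hγ := hP.γ_pos
  have h1 : D.δ P x₀ (k + 1) ω = P.γ * D.δ P x₀ k ω := by
    rw [δ_succ_of_accepted h]
    exact min_eq_left (hk.trans (hdδ.trans hP.δ₀_le_δmax))
  have h2 : Real.logb P.γ (P.γ * (D.δ P x₀ k ω / d)) = 1 + Real.logb P.γ (D.δ P x₀ k ω / d) := by
    rw [Real.logb_mul (by positivity) (by positivity), Real.logb_self_eq_one hP.γ_gt]
  have h3 : Real.logb P.γ (P.γ * (D.δ P x₀ k ω / d)) ≤ 0 := by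
    refine Real.logb_nonpos hP.γ_gt (by positivity) ?_
    rwa [← mul_div_assoc, div_le_one hd]
  have h4 : D.logGap P x₀ d k ω ≤ Real.logb P.γ (D.δ P x₀ k ω / d) := min_le_left _ _
  refine le_min ?_ (by linarith)
  rw [h1, mul_div_assoc]
  linarith

lemma abs_logGap_le (hdδ : d ≤ P.δ₀) : |D.logGap P x₀ d k ω| ≤ k := by
  rw [abs_of_nonpos logGap_nonpos]
  induction k with
  | zero => simp [logGap_zero hP hd hdδ]
  | succ k ih =>
    have := logGap_sub_one_le (D := D) (x₀ := x₀) (k := k) (ω := ω) hP hd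
    push_cast
    linarith

lemma integrable_logGap (hrun : D.IsRun P x₀ NH) (hdδ : d ≤ P.δ₀) (k : ℕ) :
    Integrable (D.logGap P x₀ d k) μ := by
  have h : Measurable[D.past k] (D.logGap P x₀ d k) :=
    ((Real.measurable_log.comp ((measurable_δ hrun k).div_const d)).div_const _).min
      measurable_const
  exact integrable_of_abs_le (past_le hrun k) h fun ω => abs_logGap_le hP hd hdδ

end LogGap

/-- The conditional probability of a true iteration. -/
lemma condProbGE_true (hP : P.Admissible) (hrun : D.IsRun P x₀ NH) (hf : ContDiff ℝ 1 f)
    (hwam : D.WellAligned μ P.αQ P.βQ) (hmodel : D.ProbFullyLinear P f x₀ μ P.κef P.κeg P.βm)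
    (hest : D.ProbAccurate P f x₀ μ P.εf P.βf) (k : ℕ) :
    CondProbGE μ (D.past k)
      (D.aligned P f x₀ k ∩ (D.modelGood P f x₀ k ∩ D.estGood P f x₀ k)) P.βtilde := by
  have hW : MeasurableSet[D.pastQ k] (D.aligned P f x₀ k) := by
    have h1 := (measurable_norm.comp ((measurable_gradient_x (P := P) hrun hf k).mono
      (D.past_le_pastQ k) le_rfl)).const_mul P.αQ
    have h2 := measurable_norm.comp (measurable_pullGrad_pastQ (P := P) hrun hf k)
    exact @measurableSet_le _ _ _ _ _ (D.pastQ k) _ _ _ _ _ h1 h2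
  have h := CondProbGE.inter (D.past_le_pastQ k) (pastQ_le hrun k)
    (hwam k _ (measurable_gradient_x hrun hf k))
    (condProbGE_modelGood_inter_estGood hP hrun hf hmodel hest k)
    (mul_pos hP.βm_pos hP.βf_pos) hW
  have e : P.βtilde = (1 - P.βQ) * (P.βm * P.βf) := by
    unfold Params.βtilde
    ring
  rw [e]
  exact h

/-- True iterations with a small radius are accepted as long as the gradient is large. -/
lemma mem_accepted_of_true (hP : P.Admissible) (hrun : D.IsRun P x₀ NH)
    (hH : ∀ k ω, NH (D.H k ω) ≤ P.κh) {ε d : ℝ} (hdε : P.ξhat * d ≤ ε) {k : ℕ} {ω : Ω}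
    (hg : ε < ‖gradient f (D.x P x₀ k ω)‖) (hk : P.γ * D.δ P x₀ k ω ≤ d)
    (hT : ω ∈ D.aligned P f x₀ k ∩ (D.modelGood P f x₀ k ∩ D.estGood P f x₀ k)) :
    ω ∈ D.accepted P x₀ k := by
  have hδ := δ_pos (D := D) (x₀ := x₀) hP k ω
  have hα := hP.αQ_pos
  have hξ := hP.ξhat_pos
  refine mem_accepted hP hrun (hH k ω) hT.2.1 hT.2.2 (le_trans ?_ hT.1)
  have h1 : D.δ P x₀ k ω ≤ d := (le_mul_of_one_le_left hδ.le hP.γ_gt.le).trans hk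
  calc _ ≤ P.αQ * P.ξhat * D.δ P x₀ k ω :=
        mul_le_mul_of_nonneg_right hP.κeg_add_le_αQ_mul_ξhat hδ.le
    _ ≤ P.αQ * P.ξhat * d := by gcongr
    _ = P.αQ * (P.ξhat * d) := by ring
    _ ≤ P.αQ * ‖gradient f (D.x P x₀ k ω)‖ := by
        gcongr
        exact hdε.trans hg.le

/-- The expected change of the cut-off logarithm of the radius before the hitting time. -/
lemma setIntegral_logGap_change_ge (hP : P.Admissible) (hrun : D.IsRun P x₀ NH)
    (hf : ContDiff ℝ 1 f) (hH : ∀ k ω, NH (D.H k ω) ≤ P.κh)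
    (hwam : D.WellAligned μ P.αQ P.βQ) (hmodel : D.ProbFullyLinear P f x₀ μ P.κef P.κeg P.βm)
    (hest : D.ProbAccurate P f x₀ μ P.εf P.βf) {ε d : ℝ} (hd : 0 < d) (hdδ : d ≤ P.δ₀)
    (hdε : P.ξhat * d ≤ ε) {k : ℕ} {A : Set Ω} (hA : MeasurableSet[D.past k] A)
    (hAε : ∀ ω ∈ A, ε < ‖gradient f (D.x P x₀ k ω)‖) :
    2 * P.βtilde * ∫ ω in A, {ω | P.γ * D.δ P x₀ k ω ≤ d}.indicator (fun _ => (1 : ℝ)) ω ∂μ -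
        μ.real A ≤
      ∫ ω in A, (D.logGap P x₀ d (k + 1) ω - D.logGap P x₀ d k ω) ∂μ := by
  have hm := past_le hrun k
  have hβ : 0 < P.βtilde := by linarith [hP.half_lt_βtilde]
  have hT := condProbGE_true hP hrun hf hwam hmodel hest k
  set T := (D.aligned P f x₀ k ∩ (D.modelGood P f x₀ k ∩ D.estGood P f x₀ k))
  set s := {ω | P.γ * D.δ P x₀ k ω ≤ d}.indicator (fun _ => (1 : ℝ)) with hs
  have hsm : Measurable[D.past k] s :=
    measurable_const.indicator (((measurable_δ hrun k).const_mul P.γ) measurableSet_Iic)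
  have hs0 : ∀ ω, 0 ≤ s ω := fun ω => Set.indicator_nonneg (fun _ _ => zero_le_one) ω
  have hs1 : ∀ ω, |s ω| ≤ 1 := fun ω => by
    rw [abs_of_nonneg (hs0 ω)]
    exact Set.indicator_le_self' (fun _ _ => zero_le_one) ω
  have isT := hT.integrable_mul hm hβ hsm hs1
  have e1 := hT.mul_setIntegral_le hm hβ hA hsm (fun ω _ => hs0 ω) hs1
  have e2 : ∫ ω in A, (2 * (s ω * T.indicator (fun _ => (1 : ℝ)) ω) - 1) ∂μ =
      2 * ∫ ω in A, s ω * T.indicator (fun _ => (1 : ℝ)) ω ∂μ - μ.real A := by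
    rw [integral_sub (isT.const_mul 2).integrableOn (integrable_const _).integrableOn,
      integral_const_mul]
    simp
  -- The integrand `2 s 1_T - 1` is `1` in true iterations with small radius and `-1` in all others,
  -- where a fall by at most one is automatic.
  refine le_trans (by linarith) (e2.symm.le.trans ?_)
  refine setIntegral_mono_on ((isT.const_mul 2).sub (integrable_const _)).integrableOn
    ((integrable_logGap hP hd hrun hdδ (k + 1)).sub
      (integrable_logGap hP hd hrun hdδ k)).integrableOn (hm _ hA) fun ω hω => ?_
  have h0 := logGap_sub_one_le (D := D) (x₀ := x₀) (k := k) (ω := ω) hP hd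
  by_cases hS : P.γ * D.δ P x₀ k ω ≤ d
  · have hS' : s ω = 1 := Set.indicator_of_mem (s := {ω | P.γ * D.δ P x₀ k ω ≤ d}) hS _
    by_cases hωT : ω ∈ T
    · have h1 := logGap_add_one_le_of_accepted hP hd hdδ
        (mem_accepted_of_true hP hrun hH hdε (hAε ω hω) hS hωT) hS
      rw [Set.indicator_of_mem hωT, hS']
      linarith
    · rw [Set.indicator_of_notMem hωT]
      linarith
  · have hS' : s ω = 0 := Set.indicator_of_notMem (s := {ω | P.γ * D.δ P x₀ k ω ≤ d}) hS _
    rw [hS']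
    linarith

/-- The expected number of iterations before the hitting time, in terms of a threshold `d` for the
radius. -/
lemma lintegral_τ_le (hP : P.Admissible) (hrun : D.IsRun P x₀ NH) (hNQ : Consistent NQ)
    (hQ : ∀ k ω, NQ (D.Q k ω) ≤ P.Qmax) (hf : ContDiff ℝ 1 f) (hfmin : ∀ x, P.fmin ≤ f x)
    (hgL : ∀ ω, LipschitzOnWith P.Lg (gradient f) (D.region P x₀ ω))
    {Lf : ℝ≥0} (hfL : ∀ ω, LipschitzOnWith Lf f (D.region P x₀ ω))
    (hH : ∀ k ω, NH (D.H k ω) ≤ P.κh)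
    (hwam : D.WellAligned μ P.αQ P.βQ) (hmodel : D.ProbFullyLinear P f x₀ μ P.κef P.κeg P.βm)
    (hest : D.ProbAccurate P f x₀ μ P.εf P.βf) {ε d : ℝ} (hd : 0 < d) (hdδ : d ≤ P.δ₀)
    (hdε : P.ξhat * d ≤ ε) :
    ∫⁻ ω, (D.τ P f x₀ ε ω : ℝ≥0∞) ∂μ ≤ ENNReal.ofReal
      (2 * P.βtilde / (2 * P.βtilde - 1) * P.γ ^ 2 / (P.ϱ * d ^ 2) * P.merit f x₀ P.δ₀) := by
  have hβ : 0 < 2 * P.βtilde - 1 := by linarith [hP.half_lt_βtilde]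
  have hβ' : 0 < P.βtilde := by linarith
  have hϱ := hP.ϱ_pos
  have hγ := hP.γ_pos
  -- The weight `c` normalizes the upward drift `2 βtilde - 1` at small radii to one. The weight `a`
  -- makes the merit decrease at the threshold radius `d / γ` worth `1 + c`, enough to pay also for
  -- a possible fall of the logarithm by one.
  set a := 2 * P.βtilde / (2 * P.βtilde - 1) * P.γ ^ 2 / (P.ϱ * d ^ 2) with ha
  set c := 1 / (2 * P.βtilde - 1) with hc
  have ha0 : 0 ≤ a := by positivity
  have hc0 : 0 ≤ c := by positivity
  have hcβ : c * (2 * P.βtilde - 1) = 1 := one_div_mul_cancel hβ.ne'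
  have hac : a * (P.ϱ * (d / P.γ) ^ 2) = 1 + c := by
    rw [ha, hc]
    field_simp
    ring
  have iφ := fun k => integrable_φ (μ := μ) hP hrun hNQ hQ hf hfL k
  have iψ := fun k => integrable_logGap (μ := μ) (D := D) hP hd hrun hdδ k
  have hA := fun k => measurableSet_notYet (P := P) (x₀ := x₀) hrun hf ε k
  have hAm := fun k => past_le hrun k _ (hA k)
  have hφ0 : ∀ k ω, 0 ≤ D.φ P f x₀ k ω := fun k ω =>
    add_nonneg (mul_nonneg hP.ν_pos.le (sub_nonneg.2 (hfmin _)))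
      (mul_nonneg (by linarith [hP.ν_lt]) (sq_nonneg _))
  refine (lintegral_toENNReal_le_tsum hAm fun k ω h => mem_notYet_of_lt_τ h).trans ?_
  refine (tsum_measure_le_of_drift (antitone_notYet ε) hAm
    (V := fun k ω => a * D.φ P f x₀ k ω - c * D.logGap P x₀ d k ω)
    (fun k => ((iφ k).const_mul a).sub ((iψ k).const_mul c)) (fun k ω => ?_) fun k => ?_).trans
    (le_of_eq ?_)
  · have h1 := mul_nonneg ha0 (hφ0 k ω)
    have h2 := mul_nonpos_of_nonneg_of_nonpos hc0
      (logGap_nonpos (D := D) (P := P) (x₀ := x₀) (d := d) (k := k) (ω := ω))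
    linarith
  · set A := D.notYet P f x₀ ε k
    set S := {ω | P.γ * D.δ P x₀ k ω ≤ d} with hS
    have hSm : MeasurableSet S :=
      past_le hrun k _ (((measurable_δ hrun k).const_mul P.γ) measurableSet_Iic)
    set s := S.indicator (fun _ => (1 : ℝ)) with hs
    have is : Integrable s μ := (integrable_const (1 : ℝ)).indicator hSm
    have e1 := setIntegral_merit_change_le hP hrun hNQ hQ hf hgL hfL hH hest hmodel (hA k)
    have e2 := setIntegral_logGap_change_ge hP hrun hf hH hwam hmodel hest hd hdδ hdε (hA k)
      fun ω hω => Set.mem_iInter₂.1 hω k (Set.mem_Iic.2 le_rfl)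
    have e3 : ∫ ω in A, -(P.ϱ * D.δ P x₀ k ω ^ 2) ∂μ ≤
        ∫ ω in A, (P.ϱ * (d / P.γ) ^ 2) * (s ω - 1) ∂μ := by
      refine setIntegral_mono ((integrable_δ_sq hP hrun k).const_mul _).neg.integrableOn
        ((is.sub (integrable_const _)).const_mul _).integrableOn fun ω => ?_
      by_cases hω : ω ∈ S
      · simp only [hs, Set.indicator_of_mem hω, sub_self, mul_zero]
        have : 0 ≤ P.ϱ * D.δ P x₀ k ω ^ 2 := by positivity
        linarith
      · simp only [hs, Set.indicator_of_notMem hω, zero_sub, mul_neg, mul_one]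
        have h1 : d / P.γ ≤ D.δ P x₀ k ω := by
          rw [div_le_iff₀ hγ]
          have : d < P.γ * D.δ P x₀ k ω := not_le.1 hω
          linarith
        have : P.ϱ * (d / P.γ) ^ 2 ≤ P.ϱ * D.δ P x₀ k ω ^ 2 := by gcongr
        linarith
    have e4 : ∫ ω in A, (P.ϱ * (d / P.γ) ^ 2) * (s ω - 1) ∂μ =
        (P.ϱ * (d / P.γ) ^ 2) * (∫ ω in A, s ω ∂μ - μ.real A) := by
      rw [integral_const_mul, integral_sub is.integrableOn (integrable_const _).integrableOn]
      simp
    have e5 : ∫ ω in A, (a * D.φ P f x₀ (k + 1) ω - c * D.logGap P x₀ d (k + 1) ω -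
          (a * D.φ P f x₀ k ω - c * D.logGap P x₀ d k ω)) ∂μ =
        a * ∫ ω in A, (D.φ P f x₀ (k + 1) ω - D.φ P f x₀ k ω) ∂μ -
          c * ∫ ω in A, (D.logGap P x₀ d (k + 1) ω - D.logGap P x₀ d k ω) ∂μ := by
      have i1 : Integrable (fun ω => a * (D.φ P f x₀ (k + 1) ω - D.φ P f x₀ k ω)) μ :=
        ((iφ (k + 1)).sub (iφ k)).const_mul a
      have i2 : Integrable
          (fun ω => c * (D.logGap P x₀ d (k + 1) ω - D.logGap P x₀ d k ω)) μ :=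
        ((iψ (k + 1)).sub (iψ k)).const_mul c
      rw [← integral_const_mul, ← integral_const_mul,
        ← integral_sub i1.integrableOn i2.integrableOn]
      congr 1
      funext ω
      ring
    rw [e5]
    have e6 := mul_le_mul_of_nonneg_left (e1.trans (e3.trans e4.le)) ha0
    have e7 := mul_le_mul_of_nonneg_left e2 hc0
    rw [← mul_assoc, hac] at e6
    -- Since `2 c βtilde = 1 + c`, the small-radius terms of `e6` and `e7` cancel and exactly
    -- `-μ.real A` remains.
    have e8 : c * (2 * P.βtilde * ∫ ω in A, s ω ∂μ - μ.real A) =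
        (1 + c) * ∫ ω in A, s ω ∂μ - c * μ.real A := by
      linear_combination (∫ ω in A, s ω ∂μ) * hcβ
    linarith
  · simp only [logGap_zero hP hd hdδ, mul_zero, sub_zero, integral_const, probReal_univ, one_smul,
      φ, x_zero, δ_zero]

end Data

end STARS

end

/-! ### Choice of the threshold and conclusion. -/

theorem mainTheorem2 (P : STARS.Params) (hP : P.Admissible) :
    ∃ ξ : ℝ, P.ξhat ≤ ξ ∧
      ∀ {n p : ℕ} (_hp : 1 ≤ p) (_hpn : p ≤ n)
        {Ω : Type*} [MeasurableSpace Ω] (μ : Measure Ω) [IsProbabilityMeasure μ]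
        (f : STARS.E n → ℝ) (x₀ : STARS.E n) (D : STARS.Data n p Ω)
        (NQ : Seminorm ℝ (Matrix (Fin n) (Fin p) ℝ))
        (NH : Seminorm ℝ (Matrix (Fin p) (Fin p) ℝ))
        (_hNQ : STARS.Consistent NQ) (_hNH : STARS.Consistent NH)
        (_hf : ContDiff ℝ 1 f)
        (_hfmin : ∀ x, P.fmin ≤ f x)
        (_hrun : D.IsRun P x₀ NH)
        (_hfLip : ∃ Lf : ℝ≥0, ∀ ω, LipschitzOnWith Lf f (D.region P x₀ ω))
        (_hgLip : ∀ ω, LipschitzOnWith P.Lg (gradient f) (D.region P x₀ ω))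
        (_hQ : ∀ k ω, NQ (D.Q k ω) ≤ P.Qmax)
        (_hH : ∀ k ω, NH (D.H k ω) ≤ P.κh)
        (_hwam : D.WellAligned μ P.αQ P.βQ)
        (_hmodel : D.ProbFullyLinear P f x₀ μ P.κef P.κeg P.βm)
        (_hest : D.ProbAccurate P f x₀ μ P.εf P.βf)
        (ε : ℝ) (_hε₀ : 0 < ε) (_hε₁ : ε < 1),
        ∫⁻ ω, (D.τ P f x₀ ε ω : ℝ≥0∞) ∂μ ≤
          ENNReal.ofReal (P.βtilde / (2 * P.βtilde - 1) *
            (P.merit f x₀ P.δ₀ * ξ ^ 2 / (P.ϱ * ε ^ 2)) + 1) := by 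
  have hγ := hP.γ_pos
  have hξ := hP.ξhat_pos
  have hδ₀ := hP.δ₀_pos
  have hm : 0 < max P.ξhat (1 / P.δ₀) := lt_max_of_lt_left hξ
  -- With `M` the maximum, the threshold is `d = ε / M`: the entry `ξhat` gives `ξhat d ≤ ε`, and `1
  -- / δ₀` together with `ε < 1` gives `d ≤ δ₀`. The drift bound needs `2 γ ^ 2 M ^ 2` where the
  -- square of the witness supplies `4 γ ^ 2 M ^ 2`; the final `+ 1` is slack.
  refine ⟨2 * P.γ * max P.ξhat (1 / P.δ₀), ?_, ?_⟩
  · refine (le_max_left _ _).trans (le_mul_of_one_le_left hm.le ?_)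
    linarith [hP.γ_gt]
  intro n p _ _ Ω _ μ _ f x₀ D NQ NH hNQ _ hf hfmin hrun hfLip hgLip hQ hH hwam hmodel hest ε
    hε₀ hε₁
  obtain ⟨Lf, hLf⟩ := hfLip
  have hd : 0 < ε / max P.ξhat (1 / P.δ₀) := div_pos hε₀ hm
  have hdδ : ε / max P.ξhat (1 / P.δ₀) ≤ P.δ₀ := by
    rw [div_le_iff₀ hm]
    have h1 : P.δ₀ * (1 / P.δ₀) ≤ P.δ₀ * max P.ξhat (1 / P.δ₀) := by
      gcongr
      exact le_max_right _ _
    rw [mul_one_div_cancel hδ₀.ne'] at h1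
    linarith
  have hdε : P.ξhat * (ε / max P.ξhat (1 / P.δ₀)) ≤ ε := by
    rw [← mul_div_assoc, div_le_iff₀ hm, mul_comm]
    gcongr
    exact le_max_left _ _
  refine (STARS.Data.lintegral_τ_le hP hrun hNQ hQ hf hfmin hgLip hLf hH hwam hmodel hest hd hdδ
    hdε).trans (ENNReal.ofReal_le_ofReal ?_)
  have hβ : 0 < 2 * P.βtilde - 1 := by linarith [hP.half_lt_βtilde]
  have hβ' : 0 < P.βtilde := by linarith
  have hϱ := hP.ϱ_pos
  have hφ : 0 ≤ P.merit f x₀ P.δ₀ :=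
    add_nonneg (mul_nonneg hP.ν_pos.le (sub_nonneg.2 (hfmin _)))
      (mul_nonneg (by linarith [hP.ν_lt]) (sq_nonneg _))
  set M := max P.ξhat (1 / P.δ₀)
  have e1 : 2 * P.βtilde / (2 * P.βtilde - 1) * P.γ ^ 2 / (P.ϱ * (ε / M) ^ 2) *
      P.merit f x₀ P.δ₀ = 2 * (P.βtilde / (2 * P.βtilde - 1) *
        (P.merit f x₀ P.δ₀ * (P.γ * M) ^ 2 / (P.ϱ * ε ^ 2))) := by
    field_simp
  have e2 : P.βtilde / (2 * P.βtilde - 1) *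
      (P.merit f x₀ P.δ₀ * (2 * P.γ * M) ^ 2 / (P.ϱ * ε ^ 2)) =
      4 * (P.βtilde / (2 * P.βtilde - 1) *
        (P.merit f x₀ P.δ₀ * (P.γ * M) ^ 2 / (P.ϱ * ε ^ 2))) := by
    ring
  have h0 : 0 ≤ P.βtilde / (2 * P.βtilde - 1) *
      (P.merit f x₀ P.δ₀ * (P.γ * M) ^ 2 / (P.ϱ * ε ^ 2)) := by positivity
  rw [e1, e2]
  linarith
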